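/- Let $\mathbb{D}$ be the open unit disc of the complex plane and $\partial\mathbb{D}$ the unit circle with Lebesgue measure. An inner function is an analytic map $f\colon\mathbb{D}\to\mathbb{D}$ whose radial limits $\lim_{r\to 1^-}f(r\xi)$ exist and have modulus one at almost every $\xi\in\partial\mathbb{D}$. Let $f$ be an inner function with $f(0)=0$ which is not a rotation (that is, $f$ is not of the form $z\mapsto cz$ with $|c|=1$). For $n\ge 1$ let $f^{n}$ be its $n$-th iterate (the $n$-fold composition of $f$ with itself on $\mathbb{D}$), and write $f^{n}(\xi)=\lim_{r\to 1^-}f^{n}(r\xi)$ for $\xi\in\partial\mathbb{D}$ whenever this limit exists. Let $\{a_n\}_{n\ge 1}$ be a sequence of complex numbers. Then the following conditions are equivalent: (a) For almost every $\xi\in\partial\mathbb{D}$, all the values $f^{n}(\xi)$, $n\ge 1$, exist and the series $\sum_{n=1}^{\infty}a_nf^{n}(\xi)$ converges. (b) The set of all $\xi\in\partial\mathbb{D}$ at which all the values $f^{n}(\xi)$, $n\ge 1$, exist and $\sup_{N}\bigl|\sum_{n=1}^{N}a_nf^{n}(\xi)\bigr|<\infty$ has positive Lebesgue measure. (c) $\sum_{n=1}^{\infty}|a_n|^{2}<\infty$.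 -/

import Mathlib

open Filter Topology MeasureTheory

noncomputable instance circleMeasurableSpace : MeasurableSpace Circle := borel Circle

instance circleBorelSpace : BorelSpace Circle := ⟨rfl⟩

/-- Normalized Lebesgue (arc length) measure on the unit circle: the image under `t ↦ exp (i t)`
of `(2π)⁻¹` times Lebesgue measure on `(-π, π]`. -/
noncomputable def circleMeasure : Measure Circle :=
  (ENNReal.ofReal (2 * Real.pi))⁻¹ •
    (volume.restrict (Set.Ioc (-Real.pi) Real.pi)).map Circle.exp

/-- `g (r ξ)` tends to `w` as `r` tends to `1` from below. -/
def HasRadialLimit (g : ℂ → ℂ) (ξ : Circle) (w : ℂ) : Prop :=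
  Tendsto (fun r : ℝ => g ((r : ℂ) * (ξ : ℂ))) (𝓝[<] 1) (𝓝 w)

/-- The boundary value `g(ξ) = lim_{r → 1} g (r ξ)`; only meaningful at the points `ξ` where this
limit exists. -/
noncomputable def boundaryValue (g : ℂ → ℂ) (ξ : Circle) : ℂ :=
  limUnder (𝓝[<] (1 : ℝ)) (fun r : ℝ => g ((r : ℂ) * (ξ : ℂ)))

/-- `f` is an inner function: it maps the open unit disc analytically into itself, and its radial
limits have modulus one at almost every point of the unit circle. The values of `f` outside the
open unit disc play no role. -/
structure IsInnerFunction (f : ℂ → ℂ) : Prop where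
  differentiableOn : DifferentiableOn ℂ f (Metric.ball 0 1)
  mapsTo : Set.MapsTo f (Metric.ball 0 1) (Metric.ball 0 1)
  radialLimit : ∀ᵐ ξ ∂circleMeasure, ∃ w : ℂ, ‖w‖ = 1 ∧ HasRadialLimit f ξ w

/-- `f` coincides on the open unit disc with a rotation `z ↦ c z`, `|c| = 1`. -/
def IsDiscRotation (f : ℂ → ℂ) : Prop :=
  ∃ c : Circle, ∀ z ∈ Metric.ball (0 : ℂ) 1, f z = c * z

/-- All the boundary values `f^n(ξ)`, `n ≥ 1`, exist, where `f^n` is the `n`-th iterate. -/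
def IteratesDefinedAt (f : ℂ → ℂ) (ξ : Circle) : Prop :=
  ∀ n : ℕ, 1 ≤ n → ∃ w : ℂ, HasRadialLimit f^[n] ξ w

/-- The partial sum `∑_{n=1}^N a_n f^n(ξ)`, where `f^n` is the `n`-th iterate of `f`. -/
noncomputable def iteratePartialSum (f : ℂ → ℂ) (a : ℕ → ℂ) (ξ : Circle) (N : ℕ) : ℂ :=
  ∑ n ∈ Finset.Icc 1 N, a n * boundaryValue f^[n] ξ

/-! The boundary values of `f` define a map `T` of the circle that carries harmonic measure at `z`
to harmonic measure at `f z` (`IsInnerFunction.exists_isBoundaryMap`). Harmonic measure composes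
well, so `T^[n]` is the boundary map of `f^[n]`, and Fatou's theorem identifies it almost everywhere
with the radial limits of `f^[n]`. The problem becomes one about the sums of `a n * T^[n] ξ`.

Since `f 0 = 0`, `T` preserves Lebesgue measure. Comparing first order terms at the origin in `∫ φ ∘
T d(harm z) = ∫ φ d(harm (f z))` shows that the conditional expectation of `ξ` given `T` is `c * T
ξ`, with `c` the conjugate of `f' 0`; the Schwarz lemma gives `‖c‖ < 1`
(`IsBoundaryMap.isCenteredShift`). Hence the functions `ξ - c * T ξ` composed with the iterates of
`T` are reversed martingale differences. Solving `b (n + 1) = c * b n + a n` rewrites the series in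
these differences, up to one boundary term, and the `ℓ²` sums of `a` and `b` are comparable.

Square summability gives convergence by Doob's maximal inequality, applied to the sums read
backwards in time (`IsCenteredShift.ae_tendsto_sum_iterate`).

For the converse, a block `Ψ` of the series has second moment of order `β`, the sum of the `‖b i‖ ^
2` in the block, and fourth moment at most of order `β ^ 2`. High iterates of `f` tend to `0`
uniformly on smaller discs, so `‖Ψ ∘ T^[N]‖ ^ 2` decorrelates from any fixed set `E`, uniformly in
the block (`IsBoundaryMap.eventually_mixing`). If the partial sums are bounded on `E` with positive
measure, the mean over `E` bounds `β` (`IsCenteredShift.summable_of_bounded`). -/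

/-! ### Lebesgue measure on the circle, Poisson kernel and harmonic measure. -/

lemma integral_circleMeasure {E : Type*} [NormedAddCommGroup E] [NormedSpace ℝ E]
    {g : Circle → E} (hg : StronglyMeasurable g) :
    ∫ ξ, g ξ ∂circleMeasure =
      (2 * Real.pi)⁻¹ • ∫ t in (-Real.pi)..Real.pi, g (Circle.exp t) := by
  rw [circleMeasure, integral_smul_measure,
    integral_map Circle.exp.continuous.measurable.aemeasurable hg.aestronglyMeasurable,
    intervalIntegral.integral_of_le (by linarith [Real.pi_pos])]
  rw [ENNReal.toReal_inv, ENNReal.toReal_ofReal (by positivity)]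

instance : IsProbabilityMeasure circleMeasure := by
  constructor
  rw [circleMeasure, Measure.smul_apply,
    Measure.map_apply Circle.exp.continuous.measurable MeasurableSet.univ]
  simp only [Set.preimage_univ, Measure.restrict_apply_univ, Real.volume_Ioc, smul_eq_mul]
  rw [show Real.pi - -Real.pi = 2 * Real.pi by ring]
  exact ENNReal.inv_mul_cancel (by simp [Real.pi_pos]) ENNReal.ofReal_ne_top

lemma continuous_circle_coe : Continuous fun ξ : Circle => (ξ : ℂ) := by fun_prop

lemma measurable_circle_coe : Measurable fun ξ : Circle => (ξ : ℂ) :=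
  Continuous.measurable (α := Circle) continuous_circle_coe

/-- On `(-π, π]` the argument inverts `Circle.exp`, so a null set of angles pulls back under
`Complex.arg` to a null set of the circle; a measurable null superset is taken to compute the image
measure. -/
lemma ae_circleMeasure_of_ae {p : Circle → Prop}
    (h : ∀ᵐ t : ℝ, p (Circle.exp t)) : ∀ᵐ ξ ∂circleMeasure, p ξ := by
  refine Measure.ae_smul_measure ?_ _
  obtain ⟨s, hs, hsm, hs0⟩ := exists_measurable_superset_of_null (mem_ae_iff.1 h)
  have harg : Measurable fun ξ : Circle => Complex.arg ξ :=
    Complex.measurable_arg.comp measurable_circle_coe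
  refine mem_ae_iff.2 (measure_mono_null (t := (fun ξ : Circle => Complex.arg ξ) ⁻¹' s) ?_ ?_)
  · intro ξ hξ
    refine hs fun h2 => hξ ?_
    simpa [Circle.exp_arg] using h2
  · rw [Measure.map_apply Circle.exp.continuous.measurable (harg hsm),
      Measure.restrict_apply' measurableSet_Ioc]
    refine measure_mono_null ?_ hs0
    rintro t ⟨ht, ht1, ht2⟩
    rwa [Set.mem_preimage, Set.mem_preimage, Circle.arg_exp ht1 ht2] at ht

lemma integral_circleMeasure_eq_circleAverage {g : ℂ → ℂ}
    (hg : Continuous fun ξ : Circle => g ξ) :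
    ∫ ξ : Circle, g ξ ∂circleMeasure = Real.circleAverage g 0 1 := by
  rw [integral_circleMeasure hg.stronglyMeasurable,
    Real.circleAverage_eq_integral_add (-Real.pi),
    intervalIntegral.integral_comp_add_right (fun t => g (circleMap 0 1 t))]
  simp only [zero_add, circleMap, Circle.coe_exp, Complex.ofReal_one, one_mul]
  rw [show 2 * Real.pi + -Real.pi = Real.pi by ring]

lemma circle_sub_ne_zero {z : ℂ} (hz : z ∈ Metric.ball (0 : ℂ) 1) (ξ : Circle) :
    (ξ : ℂ) - z ≠ 0 := by
  intro h
  have : ‖z‖ = 1 := by rw [← sub_eq_zero.1 h]; exact ξ.norm_coe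
  simp [this] at hz

lemma poissonKernel_circle (z : ℂ) (ξ : Circle) :
    poissonKernel 0 z ξ = (1 - ‖z‖ ^ 2) / ‖(ξ : ℂ) - z‖ ^ 2 := by
  simp [poissonKernel_def, Circle.norm_coe]

lemma poissonKernel_nonneg {z : ℂ} (hz : z ∈ Metric.ball (0 : ℂ) 1) (ξ : Circle) :
    0 ≤ poissonKernel 0 z ξ := by
  rw [poissonKernel_circle]
  have : ‖z‖ < 1 := by simpa using hz
  have : ‖z‖ ^ 2 ≤ 1 := pow_le_one₀ (norm_nonneg _) this.le
  apply div_nonneg (by linarith) (by positivity)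

lemma continuous_poissonKernel {z : ℂ} (hz : z ∈ Metric.ball (0 : ℂ) 1) :
    Continuous fun ξ : Circle => poissonKernel 0 z ξ := by
  simp only [poissonKernel_circle]
  refine Continuous.div (by fun_prop) (by fun_prop) fun ξ => ?_
  have := circle_sub_ne_zero hz ξ
  positivity

lemma integral_poissonKernel_smul {F : ℂ → ℂ} (hF : DiffContOnCl ℂ F (Metric.ball 0 1))
    {z : ℂ} (hz : z ∈ Metric.ball (0 : ℂ) 1) :
    ∫ ξ : Circle, poissonKernel 0 z ξ • F ξ ∂circleMeasure = F z := by
  rw [← hF.circleAverage_poissonKernel_smul hz, ← integral_circleMeasure_eq_circleAverage]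
  · rfl
  · refine (continuous_poissonKernel hz).smul ?_
    have h1 := hF.continuousOn
    rw [closure_ball _ one_ne_zero] at h1
    exact h1.comp_continuous (by fun_prop) (fun ξ => by simp [Circle.norm_coe])

/-- Harmonic measure on the unit circle seen from the point `z` of the open unit disc. -/
noncomputable def harm (z : ℂ) : Measure Circle :=
  circleMeasure.withDensity fun ξ => ENNReal.ofReal (poissonKernel 0 z ξ)

lemma integral_harm {E : Type*} [NormedAddCommGroup E] [NormedSpace ℝ E]
    {z : ℂ} (hz : z ∈ Metric.ball (0 : ℂ) 1) (g : Circle → E) :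
    ∫ ξ, g ξ ∂(harm z) = ∫ ξ : Circle, poissonKernel 0 z ξ • g ξ ∂circleMeasure := by
  rw [harm, integral_withDensity_eq_integral_toReal_smul
    (continuous_poissonKernel hz).measurable.ennreal_ofReal (by simp)]
  simp only [ENNReal.toReal_ofReal (poissonKernel_nonneg hz _)]

lemma integral_poissonKernel {z : ℂ} (hz : z ∈ Metric.ball (0 : ℂ) 1) :
    ∫ ξ : Circle, poissonKernel 0 z ξ ∂circleMeasure = 1 := by
  have := integral_poissonKernel_smul (F := fun _ => 1) diffContOnCl_const hz
  simp only [Complex.real_smul, mul_one] at this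
  rw [integral_complex_ofReal] at this
  exact_mod_cast this

lemma Continuous.integrable_circle {E : Type*} [NormedAddCommGroup E] [SecondCountableTopology E]
    {g : Circle → E} (hg : Continuous g) : Integrable g circleMeasure := by
  have := (isCompact_range hg).isBounded.exists_norm_le
  obtain ⟨C, hC⟩ := this
  exact Integrable.of_bound hg.stronglyMeasurable.aestronglyMeasurable C
    (.of_forall fun ξ => hC _ ⟨ξ, rfl⟩)

lemma isProbabilityMeasure_harm {z : ℂ} (hz : z ∈ Metric.ball (0 : ℂ) 1) :
    IsProbabilityMeasure (harm z) := by
  constructor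
  rw [harm, withDensity_apply _ MeasurableSet.univ, Measure.restrict_univ,
    ← ofReal_integral_eq_lintegral_ofReal (continuous_poissonKernel hz).integrable_circle
      (.of_forall (poissonKernel_nonneg hz)), integral_poissonKernel hz]
  simp

lemma harm_zero : harm 0 = circleMeasure := by
  simp [harm, poissonKernel_circle, Circle.norm_coe]

/-! ### The Poisson kernel in the angle, and Fatou's theorem. -/

/-- The Poisson kernel as a function of the modulus of the pole and of the angle. -/
noncomputable def angularPoisson (r s : ℝ) : ℝ := (1 - r ^ 2) / (1 - 2 * r * Real.cos s + r ^ 2)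

lemma poissonKernel_exp (r s t : ℝ) :
    poissonKernel 0 (r * Circle.exp t) (Circle.exp s) = angularPoisson r (s - t) := by
  rw [poissonKernel_circle, angularPoisson]
  congr 1
  · simp
  · rw [← Complex.normSq_eq_norm_sq, Complex.normSq_apply]
    simp only [Circle.coe_exp, Complex.sub_re, Complex.sub_im, Complex.exp_ofReal_mul_I_re,
      Complex.exp_ofReal_mul_I_im, Complex.re_ofReal_mul, Complex.im_ofReal_mul, Real.cos_sub]
    linear_combination Real.sin_sq_add_cos_sq s + r ^ 2 * Real.sin_sq_add_cos_sq t

lemma angularPoisson_denom_pos {r : ℝ} (h0 : 0 ≤ r) (h1 : r < 1) (s : ℝ) :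
    0 < 1 - 2 * r * Real.cos s + r ^ 2 := by
  nlinarith [Real.cos_le_one s]

lemma hasDerivAt_angularPoisson {r : ℝ} (h0 : 0 ≤ r) (h1 : r < 1) (s : ℝ) :
    HasDerivAt (angularPoisson r)
      (-((1 - r ^ 2) * (2 * r * Real.sin s) / (1 - 2 * r * Real.cos s + r ^ 2) ^ 2)) s := by
  have hD : HasDerivAt (fun s => 1 - 2 * r * Real.cos s + r ^ 2) (2 * r * Real.sin s) s := by
    have := (((Real.hasDerivAt_cos s).const_mul (2 * r)).const_sub 1).add_const (r ^ 2)
    exact this.congr_deriv (by ring)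
  exact ((hasDerivAt_const s (1 - r ^ 2)).div hD
    (angularPoisson_denom_pos h0 h1 s).ne').congr_deriv (by ring)

lemma continuous_angularPoisson {r : ℝ} (h0 : 0 ≤ r) (h1 : r < 1) :
    Continuous (angularPoisson r) :=
  continuous_iff_continuousAt.2 fun s => (hasDerivAt_angularPoisson h0 h1 s).continuousAt

lemma continuous_deriv_angularPoisson {r : ℝ} (h0 : 0 ≤ r) (h1 : r < 1) :
    Continuous (deriv (angularPoisson r)) := by
  have : deriv (angularPoisson r) = fun s =>
      (-((1 - r ^ 2) * (2 * r * Real.sin s) / (1 - 2 * r * Real.cos s + r ^ 2) ^ 2)) :=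
    funext fun s => (hasDerivAt_angularPoisson h0 h1 s).deriv
  rw [this]
  refine (Continuous.div (by fun_prop) (by fun_prop) fun s => ?_).neg
  have := angularPoisson_denom_pos h0 h1 s
  positivity

lemma ball_of_lt {r : ℝ} (h0 : 0 ≤ r) (h1 : r < 1) (ξ : Circle) :
    (r : ℂ) * ξ ∈ Metric.ball (0 : ℂ) 1 := by
  simpa [abs_of_nonneg h0, Circle.norm_coe] using h1

lemma integral_angularPoisson {r : ℝ} (h0 : 0 ≤ r) (h1 : r < 1) :
    ∫ s in (-Real.pi)..Real.pi, angularPoisson r s = 2 * Real.pi := by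
  have hz := ball_of_lt h0 h1 (Circle.exp 0)
  have := integral_poissonKernel hz
  rw [integral_circleMeasure (continuous_poissonKernel hz).stronglyMeasurable] at this
  simp only [poissonKernel_exp, sub_zero, smul_eq_mul] at this
  field_simp at this
  linarith

lemma MeasureTheory.LocallyIntegrable.intervalIntegrable' {ψ : ℝ → ℝ}
    (hψ : LocallyIntegrable ψ) (a b : ℝ) : IntervalIntegrable ψ volume a b :=
  intervalIntegrable_iff.mpr <|
    (hψ.integrableOn_isCompact isCompact_uIcc).mono_set Set.uIoc_subset_uIcc

/-- The denominator is `(1 - r) ^ 2 + 2 * r * (1 - cos s)`, and `1 - cos s ≥ 2 * s ^ 2 / π ^ 2` on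
`[-π, π]`; with `2 * r ≥ 1` it stays away from zero when `|s| ≥ δ`. -/
lemma norm_deriv_angularPoisson_le {r s δ : ℝ} (h0 : 1 / 2 ≤ r) (h1 : r < 1) (hδ : 0 < δ)
    (hs : |s| ≤ Real.pi) (hδs : δ ≤ |s|) :
    |deriv (angularPoisson r) s| ≤ (1 - r) * (Real.pi ^ 4 / δ ^ 4) := by
  rw [(hasDerivAt_angularPoisson (by linarith) h1 s).deriv, abs_neg, abs_div, abs_mul, abs_mul,
    abs_of_nonneg (show 0 ≤ 1 - r ^ 2 by nlinarith), abs_of_nonneg (show 0 ≤ 2 * r by linarith),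
    abs_of_nonneg (a := (1 - 2 * r * Real.cos s + r ^ 2) ^ 2) (sq_nonneg _)]
  have hpi := Real.pi_pos
  have hcos := Real.cos_le_one_sub_mul_cos_sq hs
  have hD : 2 / Real.pi ^ 2 * δ ^ 2 ≤ 1 - 2 * r * Real.cos s + r ^ 2 := by
    have h2 : δ ^ 2 ≤ s ^ 2 := by
      rw [← sq_abs s]; gcongr
    have h3 : 2 / Real.pi ^ 2 * δ ^ 2 ≤ 2 / Real.pi ^ 2 * s ^ 2 := by gcongr
    nlinarith [Real.cos_le_one s, sq_nonneg (1 - r)]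
  have h5 : |Real.sin s| ≤ 1 := Real.abs_sin_le_one s
  have hN : (1 - r ^ 2) * (2 * r * |Real.sin s|) ≤ (1 - r) * 4 := by
    have h6 : 2 * r * |Real.sin s| ≤ 2 := by nlinarith [abs_nonneg (Real.sin s)]
    calc (1 - r ^ 2) * (2 * r * |Real.sin s|) ≤ ((1 - r) * 2) * 2 :=
          mul_le_mul (by nlinarith) h6 (by positivity) (by linarith)
      _ = _ := by ring
  calc (1 - r ^ 2) * (2 * r * |Real.sin s|) / (1 - 2 * r * Real.cos s + r ^ 2) ^ 2
      ≤ (1 - r) * 4 / (2 / Real.pi ^ 2 * δ ^ 2) ^ 2 :=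
        div_le_div₀ (by linarith) hN (by positivity)
          (pow_le_pow_left₀ (by positivity) hD 2)
    _ = _ := by
        field_simp
        ring

lemma mul_deriv_angularPoisson_nonpos {r s : ℝ} (h0 : 0 ≤ r) (h1 : r < 1)
    (hs : |s| ≤ Real.pi) : |s| * |deriv (angularPoisson r) s| = -(s * deriv (angularPoisson r) s) := by
  rw [← abs_mul, abs_of_nonpos]
  rw [(hasDerivAt_angularPoisson h0 h1 s).deriv]
  have h2 : 0 ≤ s * Real.sin s := by
    rcases le_total 0 s with h | h
    · exact mul_nonneg h (Real.sin_nonneg_of_nonneg_of_le_pi h (le_of_abs_le hs))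
    · exact mul_nonneg_of_nonpos_of_nonpos h
        (Real.sin_nonpos_of_nonpos_of_neg_pi_le h (neg_le_of_abs_le hs))
  have : s * -((1 - r ^ 2) * (2 * r * Real.sin s) / (1 - 2 * r * Real.cos s + r ^ 2) ^ 2) =
    -((1 - r ^ 2) * (2 * r * (s * Real.sin s)) / (1 - 2 * r * Real.cos s + r ^ 2) ^ 2) := by
    ring
  rw [this, neg_nonpos]
  have : 0 ≤ 1 - r ^ 2 := by nlinarith
  positivity

lemma angularPoisson_pi {r : ℝ} (h0 : 0 ≤ r) : angularPoisson r Real.pi = (1 - r) / (1 + r) := by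
  rw [angularPoisson, Real.cos_pi]
  have : 1 - 2 * r * -1 + r ^ 2 = (1 + r) * (1 + r) := by ring
  rw [this]
  field_simp
  ring

lemma angularPoisson_neg_pi (r : ℝ) : angularPoisson r (-Real.pi) = angularPoisson r Real.pi := by
  rw [angularPoisson, angularPoisson, Real.cos_neg]

lemma absolutelyContinuousOnInterval_angularPoisson {r : ℝ} (h0 : 0 ≤ r) (h1 : r < 1) (a b : ℝ) :
    AbsolutelyContinuousOnInterval (angularPoisson r) a b :=
  ContDiffOn.absolutelyContinuousOnInterval (contDiff_one_iff_deriv.2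
    ⟨fun s => (hasDerivAt_angularPoisson h0 h1 s).differentiableAt,
      continuous_deriv_angularPoisson h0 h1⟩).contDiffOn

/-- Integration by parts against the primitive of `ψ`, which is only absolutely continuous. It moves
the analysis of the radial limit to the behaviour of that primitive near `0`. -/
lemma integral_angularPoisson_mul_eq {r : ℝ} (h0 : 0 ≤ r) (h1 : r < 1) {ψ : ℝ → ℝ}
    (hψ : LocallyIntegrable ψ) :
    ∫ s in (-Real.pi)..Real.pi, angularPoisson r s * ψ s =
      (1 - r) / (1 + r) * ((∫ t in (0)..Real.pi, ψ t) - ∫ t in (0)..(-Real.pi), ψ t) -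
      ∫ s in (-Real.pi)..Real.pi, deriv (angularPoisson r) s * ∫ t in (0)..s, ψ t := by
  have hi : IntervalIntegrable ψ volume (-Real.pi) Real.pi := (hψ.intervalIntegrable' _ _)
  have hpi := Real.pi_pos
  have hac := hi.absolutelyContinuousOnInterval_intervalIntegral (c := 0)
    (by rw [Set.uIcc_of_le (by linarith)]; constructor <;> linarith)
  have key := (absolutelyContinuousOnInterval_angularPoisson h0 h1
    (-Real.pi) Real.pi).integral_mul_deriv_eq_deriv_mul hac
  rw [angularPoisson_neg_pi, angularPoisson_pi h0, ← mul_sub] at key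
  rw [← key]
  refine intervalIntegral.integral_congr_ae ?_
  filter_upwards [LocallyIntegrable.ae_hasDerivAt_integral hψ] with s hs _
  rw [(hs 0).deriv]

/-- The case `ψ = 1` of the integration by parts: the kernel has mass `2π` and the boundary term is
nonnegative. -/
lemma integral_mul_deriv_angularPoisson {r : ℝ} (h0 : 0 ≤ r) (h1 : r < 1) :
    ∫ s in (-Real.pi)..Real.pi, -(s * deriv (angularPoisson r) s) ≤ 2 * Real.pi := by
  have key := integral_angularPoisson_mul_eq h0 h1 (ψ := fun _ => 1) (locallyIntegrable_const 1)
  simp only [mul_one, integral_angularPoisson h0 h1, intervalIntegral.integral_const, sub_zero,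
    smul_eq_mul] at key
  rw [intervalIntegral.integral_neg]
  simp only [mul_comm _ (deriv (angularPoisson r) _)]
  have : 0 ≤ (1 - r) / (1 + r) * (Real.pi - -Real.pi) :=
    mul_nonneg (div_nonneg (by linarith) (by linarith)) (by linarith [Real.pi_pos])
  linarith

/-- The Poisson integral of `ψ` tends to zero radially at `0` when the primitive of `ψ` has
derivative zero there. -/
lemma tendsto_integral_angularPoisson_mul {ψ : ℝ → ℝ} (hψ : LocallyIntegrable ψ)
    (hder : HasDerivAt (fun x => ∫ t in (0)..x, ψ t) 0 0) :
    Tendsto (fun r => ∫ s in (-Real.pi)..Real.pi, angularPoisson r s * ψ s) (𝓝[<] 1) (𝓝 0) := by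
  set Ψ : ℝ → ℝ := fun x => ∫ t in (0)..x, ψ t with hΨ
  have hpi := Real.pi_pos
  have hΨc : Continuous Ψ :=
    intervalIntegral.continuous_primitive (fun a b => (hψ.intervalIntegrable' _ _)) 0
  obtain ⟨M, hM⟩ := (isCompact_Icc (a := -Real.pi) (b := Real.pi)).exists_bound_of_continuousOn
    hΨc.continuousOn
  have hM0 : 0 ≤ M := (norm_nonneg _).trans (hM 0 ⟨by linarith, by linarith⟩)
  rw [Metric.tendsto_nhds]
  intro ε hε
  -- The zero derivative means `Ψ s = o(s)`. As `-s P'(s)` has integral at most `2π`, the constant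
  -- `8π` makes the part near `0` cost at most `ε / 4`.
  have hev : ∀ᶠ s in 𝓝 (0 : ℝ), |Ψ s| ≤ ε / (8 * Real.pi) * |s| := by
    have := hder.isLittleO
    have := this.def (show 0 < ε / (8 * Real.pi) by positivity)
    filter_upwards [this] with s hs
    simpa [hΨ] using hs
  obtain ⟨δ, hδ, hδ'⟩ := Metric.eventually_nhds_iff.1 hev
  set C := M * (Real.pi ^ 4 / δ ^ 4) * (2 * Real.pi) + 2 * M with hC
  have hlim : ∀ᶠ r in 𝓝[<] (1 : ℝ), (1 - r) * C < ε / 2 := by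
    have h1 : Tendsto (fun r : ℝ => (1 - r) * C) (𝓝[<] 1) (𝓝 ((1 - 1) * C)) :=
      Tendsto.mono_left (Continuous.tendsto (by fun_prop) _) nhdsWithin_le_nhds
    rw [sub_self, zero_mul] at h1
    exact h1.eventually_lt_const (by positivity)
  have hr2 : ∀ᶠ r in 𝓝[<] (1 : ℝ), 1 / 2 < r :=
    eventually_nhdsWithin_of_eventually_nhds (eventually_gt_nhds (by norm_num))
  filter_upwards [hlim, hr2, self_mem_nhdsWithin] with r hr1 hr2 hr3
  have hr3 : r < 1 := hr3
  have hr0 : 0 ≤ r := by linarith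
  rw [dist_zero_right, integral_angularPoisson_mul_eq hr0 hr3 hψ]
  have hb1 : ‖(1 - r) / (1 + r) * ((∫ t in (0)..Real.pi, ψ t) - ∫ t in (0)..(-Real.pi), ψ t)‖
      ≤ (1 - r) * (2 * M) := by
    rw [norm_mul]
    refine mul_le_mul ?_ ?_ (norm_nonneg _) (by linarith)
    · rw [Real.norm_of_nonneg (div_nonneg (by linarith) (by linarith))]
      exact div_le_self (by linarith) (by linarith)
    · refine (norm_sub_le _ _).trans ?_
      have := hM Real.pi ⟨by linarith, by linarith⟩
      have := hM (-Real.pi) ⟨by linarith, by linarith⟩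
      linarith
  have hcd := continuous_deriv_angularPoisson hr0 hr3
  have hb2 : ‖∫ s in (-Real.pi)..Real.pi, deriv (angularPoisson r) s * Ψ s‖ ≤
      ∫ s in (-Real.pi)..Real.pi, (ε / (8 * Real.pi) * -(s * deriv (angularPoisson r) s) +
        (1 - r) * (M * (Real.pi ^ 4 / δ ^ 4))) := by
    refine intervalIntegral.norm_integral_le_of_norm_le (by linarith) ?_ ?_
    · refine .of_forall fun s hs => ?_
      have hs' : |s| ≤ Real.pi := abs_le.2 ⟨by linarith [hs.1], hs.2⟩
      rw [norm_mul, ← mul_deriv_angularPoisson_nonpos hr0 hr3 hs', Real.norm_eq_abs,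
        Real.norm_eq_abs]
      rcases lt_or_ge |s| δ with h | h
      · have h2 := hδ' (y := s) (by simpa using h)
        calc |deriv (angularPoisson r) s| * |Ψ s|
            ≤ |deriv (angularPoisson r) s| * (ε / (8 * Real.pi) * |s|) := by gcongr
          _ = ε / (8 * Real.pi) * (|s| * |deriv (angularPoisson r) s|) := by ring
          _ ≤ _ := le_add_of_nonneg_right (mul_nonneg (by linarith) (by positivity))
      · have h2 := norm_deriv_angularPoisson_le hr2.le hr3 hδ hs' h
        have h3 := hM s ⟨by linarith [hs.1], hs.2⟩
        calc |deriv (angularPoisson r) s| * |Ψ s|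
            ≤ ((1 - r) * (Real.pi ^ 4 / δ ^ 4)) * M := by
              gcongr
              exact h3
          _ = (1 - r) * (M * (Real.pi ^ 4 / δ ^ 4)) := by ring
          _ ≤ _ := le_add_of_nonneg_left (by positivity)
    · exact Continuous.intervalIntegrable (by fun_prop) _ _
  rw [intervalIntegral.integral_add (Continuous.intervalIntegrable (by fun_prop) _ _)
    (Continuous.intervalIntegrable (by fun_prop) _ _), intervalIntegral.integral_const_mul,
    intervalIntegral.integral_const, smul_eq_mul] at hb2
  have hb3 : ε / (8 * Real.pi) * (∫ s in (-Real.pi)..Real.pi, -(s * deriv (angularPoisson r) s)) ≤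
      ε / 4 := by
    calc _ ≤ ε / (8 * Real.pi) * (2 * Real.pi) := by
          gcongr
          exact integral_mul_deriv_angularPoisson hr0 hr3
      _ = _ := by field_simp; ring
  calc _ ≤ _ := norm_sub_le _ _
    _ ≤ (1 - r) * C + ε / 4 := by rw [hC]; linarith
    _ < ε := by linarith

/-- **Fatou's theorem** for Poisson integrals of bounded real functions. -/
theorem ae_tendsto_integral_harm_real {φ : Circle → ℝ} (hφ : Measurable φ) {C : ℝ}
    (hC : ∀ ξ, |φ ξ| ≤ C) :
    ∀ᵐ ξ : Circle ∂circleMeasure,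
      Tendsto (fun r : ℝ => ∫ η, φ η ∂(harm ((r : ℂ) * ξ))) (𝓝[<] 1) (𝓝 (φ ξ)) := by
  apply ae_circleMeasure_of_ae
  have hloc : LocallyIntegrable (fun s => φ (Circle.exp s)) volume :=
    (locallyIntegrable_const C).mono
      (hφ.comp Circle.exp.continuous.measurable).aestronglyMeasurable
      (.of_forall fun s => by
        simpa using (hC (Circle.exp s)).trans (le_abs_self C))
  filter_upwards [LocallyIntegrable.ae_hasDerivAt_integral hloc] with t ht
  -- Rotating the boundary point to angle `0` and subtracting the expected limit gives a primitive
  -- with zero derivative there, by Lebesgue differentiation at `t`.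
  set ψ : ℝ → ℝ := fun s => φ (Circle.exp (s + t)) - φ (Circle.exp t) with hψdef
  have hloc' : LocallyIntegrable ψ volume := by
    refine (locallyIntegrable_const (2 * C)).mono ?_ (.of_forall fun s => ?_)
    · refine Measurable.aestronglyMeasurable ?_
      exact (hφ.comp (Circle.exp.continuous.measurable.comp (measurable_id.add_const t))).sub_const _
    · have h1 := hC (Circle.exp (s + t))
      have h2 := hC (Circle.exp t)
      refine (norm_sub_le _ _).trans (le_trans ?_ (le_abs_self _))
      rw [Real.norm_eq_abs, Real.norm_eq_abs]
      linarith
  have hint : ∀ a b, IntervalIntegrable (fun s => φ (Circle.exp s)) volume a b :=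
    fun a b => hloc.intervalIntegrable' a b
  have hder : HasDerivAt (fun x => ∫ s in (0)..x, ψ s) 0 0 := by
    have h1 : (fun x => ∫ s in (0)..x, ψ s) =
        fun x => (∫ s in t..(x + t), φ (Circle.exp s)) - x * φ (Circle.exp t) := by
      ext x
      rw [hψdef, intervalIntegral.integral_sub ?_ (by simp)]
      · rw [intervalIntegral.integral_comp_add_right (fun s => φ (Circle.exp s))]
        simp
      · have := (hint (0 + t) (x + t)).comp_add_right t
        simpa using this
    rw [h1]
    have h2 : HasDerivAt (fun x => ∫ s in t..(x + t), φ (Circle.exp s)) (φ (Circle.exp t)) 0 := by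
      have h3 := ht t
      rw [← zero_add t] at h3
      simpa using h3.comp_add_const 0 t
    exact (h2.sub ((hasDerivAt_id 0).mul_const (φ (Circle.exp t)))).congr_deriv (by simp)
  have key := (tendsto_integral_angularPoisson_mul hloc' hder).const_mul (2 * Real.pi)⁻¹
  have key2 := key.add_const (φ (Circle.exp t))
  rw [mul_zero, zero_add] at key2
  refine key2.congr' ?_
  have hr2 : ∀ᶠ r in 𝓝[<] (1 : ℝ), 0 < r :=
    eventually_nhdsWithin_of_eventually_nhds (eventually_gt_nhds (by norm_num))
  filter_upwards [hr2, self_mem_nhdsWithin] with r hr0 hr1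
  have hz := ball_of_lt hr0.le hr1 (Circle.exp t)
  rw [integral_harm hz, integral_circleMeasure
    (g := fun ξ => poissonKernel 0 ((r : ℂ) * Circle.exp t) ξ • φ ξ)
    ((continuous_poissonKernel hz).measurable.smul hφ).stronglyMeasurable]
  simp only [poissonKernel_exp, smul_eq_mul]
  have hper : Function.Periodic (fun s => angularPoisson r (s - t) * φ (Circle.exp s))
      (2 * Real.pi) := by
    intro s
    simp only [angularPoisson, Circle.exp_add_two_pi, add_sub_right_comm, Real.cos_add_two_pi]
  have hshift := hper.intervalIntegral_add_eq (-Real.pi) (-Real.pi + t)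
  rw [show -Real.pi + 2 * Real.pi = Real.pi by ring,
    show -Real.pi + t + 2 * Real.pi = Real.pi + t by ring,
    ← intervalIntegral.integral_comp_add_right
      (fun s => angularPoisson r (s - t) * φ (Circle.exp s))] at hshift
  simp only [add_sub_cancel_right] at hshift
  rw [hshift]
  have hcp := continuous_angularPoisson hr0.le hr1
  have hsplit : ∫ s in (-Real.pi)..Real.pi, angularPoisson r s * ψ s =
      (∫ s in (-Real.pi)..Real.pi, angularPoisson r s * φ (Circle.exp (s + t))) -
        2 * Real.pi * φ (Circle.exp t) := by
    rw [← integral_angularPoisson hr0.le hr1, ← intervalIntegral.integral_mul_const,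
      ← intervalIntegral.integral_sub]
    · simp only [hψdef, mul_sub]
    · refine IntervalIntegrable.continuousOn_mul ?_ hcp.continuousOn
      have := (hint (-Real.pi + t) (Real.pi + t)).comp_add_right t
      simpa using this
    · exact Continuous.intervalIntegrable (by fun_prop) _ _
  rw [hsplit]
  have := Real.pi_pos
  field_simp
  ring

theorem ae_tendsto_integral_harm {φ : Circle → ℂ} (hφ : Measurable φ) {C : ℝ}
    (hC : ∀ ξ, ‖φ ξ‖ ≤ C) :
    ∀ᵐ ξ : Circle ∂circleMeasure,
      Tendsto (fun r : ℝ => ∫ η, φ η ∂(harm ((r : ℂ) * ξ))) (𝓝[<] 1) (𝓝 (φ ξ)) := by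
  have hre := ae_tendsto_integral_harm_real (Complex.measurable_re.comp hφ)
    (fun ξ => (Complex.abs_re_le_norm _).trans (hC ξ))
  have him := ae_tendsto_integral_harm_real (Complex.measurable_im.comp hφ)
    (fun ξ => (Complex.abs_im_le_norm _).trans (hC ξ))
  filter_upwards [hre, him] with ξ h1 h2
  have h3 := (Complex.continuous_ofReal.tendsto _).comp h1
  have h4 := ((Complex.continuous_ofReal.tendsto _).comp h2).mul_const Complex.I
  have h5 := h3.add h4
  simp only [Function.comp_apply, Complex.re_add_im] at h5
  refine h5.congr' ?_
  have hr2 : ∀ᶠ r in 𝓝[<] (1 : ℝ), 0 < r :=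
    eventually_nhdsWithin_of_eventually_nhds (eventually_gt_nhds (by norm_num))
  filter_upwards [hr2, self_mem_nhdsWithin] with r hr0 hr1
  have := isProbabilityMeasure_harm (ball_of_lt hr0.le hr1 ξ)
  have hint : Integrable φ (harm ((r : ℂ) * ξ)) :=
    Integrable.of_bound hφ.aestronglyMeasurable C (.of_forall hC)
  exact integral_re_add_im hint

/-! ### The boundary map of an inner function. -/

/-- Finite measures on the circle with equal Fourier coefficients of nonnegative index are equal. -/
lemma Circle.measure_ext {μ ν : Measure Circle} [IsFiniteMeasure μ] [IsFiniteMeasure ν]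
    (h : ∀ k : ℕ, ∫ ξ : Circle, (ξ : ℂ) ^ k ∂μ = ∫ ξ : Circle, (ξ : ℂ) ^ k ∂ν) : μ = ν := by
  let e : BoundedContinuousFunction Circle ℂ :=
    BoundedContinuousFunction.mkOfCompact ⟨fun ξ : Circle => (ξ : ℂ), continuous_circle_coe⟩
  have he : ∀ ξ : Circle, e ξ = ξ := fun ξ => rfl
  have hZ : ∀ k : ℤ, ∫ ξ : Circle, ((ξ ^ k : Circle) : ℂ) ∂μ =
      ∫ ξ : Circle, ((ξ ^ k : Circle) : ℂ) ∂ν := by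
    intro k
    obtain ⟨n, rfl | rfl⟩ := k.eq_nat_or_neg
    · simpa using h n
    · simp only [zpow_neg, zpow_natCast, Circle.coe_inv_eq_conj, Circle.coe_pow]
      rw [integral_conj, integral_conj, h n]
  -- The star algebra generated by the coordinate separates points and is spanned by the integer
  -- powers; negative powers reduce to positive ones by conjugation.
  refine ext_of_forall_mem_subalgebra_integral_eq_of_polish (𝕜 := ℂ)
    (A := StarAlgebra.adjoin ℂ {e}) ?_ ?_
  · intro x y hxy
    refine ⟨fun ξ => (ξ : ℂ), ?_, fun hc => hxy (Circle.ext hc)⟩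
    refine ⟨e.toContinuousMap, ⟨e, StarAlgebra.self_mem_adjoin_singleton ℂ e, rfl⟩, rfl⟩
  · intro g hg
    have hg' : g ∈ Submodule.span ℂ (Submonoid.closure ({e} ∪ star {e}) : Set _) := by
      rw [← Algebra.adjoin_eq_span]
      exact hg
    have hmono : ∀ g ∈ Submonoid.closure ({e} ∪ star {e}), ∃ k : ℤ, ∀ ξ : Circle,
        (g : BoundedContinuousFunction Circle ℂ) ξ = ((ξ ^ k : Circle) : ℂ) := by
      intro g hg
      induction hg using Submonoid.closure_induction with
      | mem x hx =>
        rcases hx with rfl | hx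
        · exact ⟨1, fun ξ => by simp [he]⟩
        · refine ⟨-1, fun ξ => ?_⟩
          have hx' : star x = e := hx
          rw [← star_star x, hx', zpow_neg_one, Circle.coe_inv_eq_conj]
          rfl
      | one => exact ⟨0, fun ξ => by simp⟩
      | mul x y _ _ hx hy =>
        obtain ⟨k, hk⟩ := hx
        obtain ⟨l, hl⟩ := hy
        exact ⟨k + l, fun ξ => by
          rw [BoundedContinuousFunction.mul_apply, hk, hl, zpow_add, Circle.coe_mul]⟩
    clear hg
    induction hg' using Submodule.span_induction with
    | mem x hx =>
      obtain ⟨k, hk⟩ := hmono x hx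
      simp only [hk, hZ k]
    | zero => simp
    | add x y _ _ hx hy =>
      simp only [BoundedContinuousFunction.add_apply]
      rw [integral_add (x.integrable μ) (y.integrable μ),
        integral_add (x.integrable ν) (y.integrable ν)]
      exact congrArg₂ _ hx hy
    | smul a x _ hx =>
      simp only [BoundedContinuousFunction.smul_apply, integral_smul, hx]

/-- `T` is the boundary map of the self-map `g` of the disc: it transports the harmonic measure
seen from `z` to the one seen from `g z`. -/
structure IsBoundaryMap (g : ℂ → ℂ) (T : Circle → Circle) : Prop where
  measurable : Measurable T
  mapsTo : Set.MapsTo g (Metric.ball 0 1) (Metric.ball 0 1)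
  map_harm : ∀ z ∈ Metric.ball (0 : ℂ) 1, (harm z).map T = harm (g z)

lemma IsBoundaryMap.comp {g h : ℂ → ℂ} {S T : Circle → Circle} (hg : IsBoundaryMap g S)
    (hh : IsBoundaryMap h T) : IsBoundaryMap (g ∘ h) (S ∘ T) where
  measurable := hg.measurable.comp hh.measurable
  mapsTo := hg.mapsTo.comp hh.mapsTo
  map_harm z hz := by
    rw [← Measure.map_map hg.measurable hh.measurable, hh.map_harm z hz,
      hg.map_harm _ (hh.mapsTo hz), Function.comp_apply]

lemma IsBoundaryMap.iterate {g : ℂ → ℂ} {T : Circle → Circle} (h : IsBoundaryMap g T) (n : ℕ) :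
    IsBoundaryMap g^[n] T^[n] := by
  induction n with
  | zero => exact ⟨measurable_id, Set.mapsTo_id _, fun z _ => Measure.map_id⟩
  | succ n ih =>
    rw [Function.iterate_succ, Function.iterate_succ]
    exact ih.comp h

lemma integral_harm_coe_pow {z : ℂ} (hz : z ∈ Metric.ball (0 : ℂ) 1) (k : ℕ) :
    ∫ ξ : Circle, (ξ : ℂ) ^ k ∂(harm z) = z ^ k := by
  rw [integral_harm hz]
  exact integral_poissonKernel_smul (F := fun w => w ^ k)
    (Differentiable.diffContOnCl (by fun_prop)) hz

lemma IsBoundaryMap.integral_comp {g : ℂ → ℂ} {T : Circle → Circle} (h : IsBoundaryMap g T)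
    {E : Type*} [NormedAddCommGroup E] [NormedSpace ℝ E] {ψ : Circle → E}
    (hψ : StronglyMeasurable ψ) {z : ℂ} (hz : z ∈ Metric.ball (0 : ℂ) 1) :
    ∫ ξ, ψ (T ξ) ∂(harm z) = ∫ ξ, ψ ξ ∂(harm (g z)) := by
  rw [← h.map_harm z hz, integral_map h.measurable.aemeasurable hψ.aestronglyMeasurable]

/-- The Poisson integral of `T` is `g` itself, so this is Fatou's theorem. Applied to `f^[n]` and
`T^[n]`, it avoids composing radial limits. -/
lemma IsBoundaryMap.hasRadialLimit {g : ℂ → ℂ} {T : Circle → Circle} (h : IsBoundaryMap g T) :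
    ∀ᵐ ξ : Circle ∂circleMeasure, HasRadialLimit g ξ (T ξ) := by
  have := ae_tendsto_integral_harm (φ := fun ξ => (T ξ : ℂ))
    (measurable_circle_coe.comp h.measurable) (C := 1) (fun ξ => (Circle.norm_coe _).le)
  filter_upwards [this] with ξ hξ
  refine Tendsto.congr' ?_ hξ
  have hr2 : ∀ᶠ r in 𝓝[<] (1 : ℝ), 0 < r :=
    eventually_nhdsWithin_of_eventually_nhds (eventually_gt_nhds (by norm_num))
  filter_upwards [hr2, self_mem_nhdsWithin] with r hr0 hr1
  have hz := ball_of_lt hr0.le hr1 ξ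
  rw [h.integral_comp (ψ := fun ξ : Circle => (ξ : ℂ)) measurable_circle_coe.stronglyMeasurable hz]
  simpa using integral_harm_coe_pow (h.mapsTo hz) 1

/-- The `k`-th moment of the image of `harm z` is the limit of the Poisson integrals at `z` of `f (ρ
ξ) ^ k`, that is of `f (ρ z) ^ k`. It equals `f z ^ k`, the `k`-th moment of `harm (f z)`, and
moments determine the measure. -/
lemma IsInnerFunction.exists_isBoundaryMap {f : ℂ → ℂ} (hf : IsInnerFunction f) :
    ∃ T, IsBoundaryMap f T := by
  set ρ : ℕ → ℝ := fun n => 1 - 1 / ((n : ℝ) + 2) with hρ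
  have hρ0 : ∀ n, 0 ≤ ρ n := by
    intro n
    have : 1 / ((n : ℝ) + 2) ≤ 1 := by
      rw [div_le_one (by positivity)]
      linarith [n.cast_nonneg (α := ℝ)]
    simp only [hρ]
    linarith
  have hρ1 : ∀ n, ρ n < 1 := by
    intro n
    have : 0 < 1 / ((n : ℝ) + 2) := by positivity
    simp only [hρ]
    linarith
  have hρlim : Tendsto ρ atTop (𝓝[<] 1) := by
    refine tendsto_nhdsWithin_iff.2 ⟨?_, .of_forall hρ1⟩
    have h1 : Tendsto (fun n : ℕ => 1 / ((n : ℝ) + 2)) atTop (𝓝 0) := by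
      have := (tendsto_add_atTop_iff_nat 1).2 (tendsto_one_div_add_atTop_nhds_zero_nat (𝕜 := ℝ))
      refine this.congr fun n => ?_
      push_cast
      ring
    simpa [hρ] using h1.const_sub 1
  have hcont : ∀ n, Continuous fun ξ : Circle => f ((ρ n : ℂ) * ξ) := fun n =>
    hf.differentiableOn.continuousOn.comp_continuous (by fun_prop)
      fun ξ => ball_of_lt (hρ0 n) (hρ1 n) ξ
  obtain ⟨F, hFm, hF⟩ : ∃ F : Circle → ℂ, Measurable F ∧ ∀ᵐ ξ : Circle ∂circleMeasure,
      Tendsto (fun n => f ((ρ n : ℂ) * ξ)) atTop (𝓝 (F ξ)) := by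
    refine measurable_limit_of_tendsto_metrizable_ae (fun n => (hcont n).measurable.aemeasurable) ?_
    filter_upwards [hf.radialLimit] with ξ ⟨w, _, hw⟩
    exact ⟨w, hw.comp hρlim⟩
  -- Normalizing through the argument makes `T` measurable and circle-valued everywhere; it agrees
  -- with `F` wherever `‖F ξ‖ = 1`.
  set T : Circle → Circle := fun ξ => Circle.exp (Complex.arg (F ξ)) with hT
  have hTm : Measurable T :=
    Circle.exp.continuous.measurable.comp (Complex.measurable_arg.comp hFm)
  have hTF : ∀ᵐ ξ : Circle ∂circleMeasure,
      Tendsto (fun n => f ((ρ n : ℂ) * ξ)) atTop (𝓝 (T ξ : ℂ)) := by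
    filter_upwards [hF, hf.radialLimit] with ξ h1 ⟨w, hw1, hw⟩
    have : F ξ = w := tendsto_nhds_unique h1 (hw.comp hρlim)
    have h2 : (T ξ : ℂ) = F ξ := by
      have := Complex.norm_mul_exp_arg_mul_I (F ξ)
      rw [‹F ξ = w›, hw1] at this
      simpa [hT, ‹F ξ = w›] using this
    rwa [h2]
  refine ⟨T, hTm, hf.mapsTo, fun z hz => ?_⟩
  have := isProbabilityMeasure_harm hz
  have := isProbabilityMeasure_harm (hf.mapsTo hz)
  have := Measure.isProbabilityMeasure_map (μ := harm z) hTm.aemeasurable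
  refine Circle.measure_ext fun k => ?_
  rw [integral_harm_coe_pow (hf.mapsTo hz), integral_map hTm.aemeasurable
    (measurable_circle_coe.pow_const k).aestronglyMeasurable]
  have hlim1 : Tendsto (fun n => ∫ ξ : Circle, f ((ρ n : ℂ) * ξ) ^ k ∂(harm z)) atTop
      (𝓝 (∫ ξ, (T ξ : ℂ) ^ k ∂(harm z))) := by
    refine tendsto_integral_of_dominated_convergence (fun _ => 1)
      (fun n => ((hcont n).pow k).measurable.aestronglyMeasurable) (integrable_const 1) ?_ ?_
    · refine fun n => .of_forall fun ξ => ?_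
      rw [norm_pow]
      refine pow_le_one₀ (norm_nonneg _) ?_
      have := hf.mapsTo (ball_of_lt (hρ0 n) (hρ1 n) ξ)
      rw [mem_ball_zero_iff] at this
      exact this.le
    · have hac : harm z ≪ circleMeasure := withDensity_absolutelyContinuous _ _
      filter_upwards [hac.ae_le hTF] with ξ hξ
      exact hξ.pow k
  have hlim2 : Tendsto (fun n => f ((ρ n : ℂ) * z) ^ k) atTop (𝓝 (f z ^ k)) := by
    have h1 : ContinuousAt f z :=
      (hf.differentiableOn.differentiableAt (Metric.isOpen_ball.mem_nhds hz)).continuousAt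
    have h2 : Tendsto (fun n => (ρ n : ℂ) * z) atTop (𝓝 z) := by
      have h3 := (Complex.continuous_ofReal.tendsto _).comp (tendsto_nhdsWithin_iff.1 hρlim).1
      simpa using h3.mul_const z
    exact (h1.tendsto.comp h2).pow k
  refine tendsto_nhds_unique hlim1 (hlim2.congr fun n => ?_)
  rw [integral_harm hz]
  refine (integral_poissonKernel_smul (F := fun w => f ((ρ n : ℂ) * w) ^ k) ?_ hz).symm
  refine DifferentiableOn.diffContOnCl ?_
  rw [closure_ball _ one_ne_zero]
  refine DifferentiableOn.pow (hf.differentiableOn.comp (by fun_prop) fun w hw => ?_) k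
  rw [mem_closedBall_zero_iff] at hw
  rw [mem_ball_zero_iff, norm_mul, Complex.norm_real, Real.norm_of_nonneg (hρ0 n)]
  exact (mul_le_of_le_one_right (hρ0 n) hw).trans_lt (hρ1 n)

/-! ### Expansion of Poisson integrals at the origin. -/

lemma integrable_circle_of_bound {E : Type*} [NormedAddCommGroup E] {μ : Measure Circle}
    [IsFiniteMeasure μ] {g : Circle → E} (hg : StronglyMeasurable g) {C : ℝ}
    (hC : ∀ ξ, ‖g ξ‖ ≤ C) : Integrable g μ :=
  Integrable.of_bound hg.aestronglyMeasurable C (.of_forall hC)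

lemma poissonKernel_eq_re {z : ℂ} (hz : z ∈ Metric.ball (0 : ℂ) 1) (ξ : Circle) :
    poissonKernel 0 z ξ = 1 + 2 * (z / (ξ - z)).re := by
  rw [poissonKernel_eq_re_herglotzRieszKernel]
  have h := circle_sub_ne_zero hz ξ
  have : herglotzRieszKernel 0 z ξ = 1 + 2 * (z / (ξ - z)) := by
    rw [herglotzRieszKernel_def, sub_zero, sub_zero]
    field_simp
    ring
  simp [Function.comp_apply, this]

lemma half_le_norm_circle_sub {z : ℂ} (hz : ‖z‖ ≤ 1 / 2) (ξ : Circle) :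
    1 / 2 ≤ ‖(ξ : ℂ) - z‖ := by
  have := norm_sub_norm_le (ξ : ℂ) z
  rw [Circle.norm_coe] at this
  linarith

lemma abs_poissonKernel_sub_one_le {z : ℂ} (hz : ‖z‖ ≤ 1 / 2) (ξ : Circle) :
    |poissonKernel 0 z ξ - 1| ≤ 4 * ‖z‖ := by
  rw [poissonKernel_eq_re (by rw [mem_ball_zero_iff]; linarith), add_sub_cancel_left, abs_mul,
    abs_two]
  have h1 := Complex.abs_re_le_norm (z / (ξ - z))
  have h2 : ‖z / (ξ - z)‖ ≤ ‖z‖ / (1 / 2) := by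
    rw [norm_div]
    gcongr
    exact half_le_norm_circle_sub hz ξ
  linarith

lemma abs_poissonKernel_sub_le {z : ℂ} (hz : ‖z‖ ≤ 1 / 2) (ξ : Circle) :
    |poissonKernel 0 z ξ - 1 - 2 * (z * (starRingEnd ℂ) ξ).re| ≤ 4 * ‖z‖ ^ 2 := by
  have hb : z ∈ Metric.ball (0 : ℂ) 1 := by rw [mem_ball_zero_iff]; linarith
  have hne := circle_sub_ne_zero hb ξ
  have h3 : z / (ξ - z) - z * (starRingEnd ℂ) ξ = z ^ 2 * (starRingEnd ℂ) ξ / (ξ - z) := by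
    rw [← Circle.coe_inv_eq_conj, Circle.coe_inv]
    have := ξ.coe_ne_zero
    field_simp
    ring
  rw [poissonKernel_eq_re hb, add_sub_cancel_left, ← mul_sub, ← Complex.sub_re, h3, abs_mul,
    abs_two]
  have h1 := Complex.abs_re_le_norm (z ^ 2 * (starRingEnd ℂ) ξ / (ξ - z))
  have h2 : ‖z ^ 2 * (starRingEnd ℂ) ξ / (ξ - z)‖ ≤ ‖z‖ ^ 2 / (1 / 2) := by
    rw [norm_div, norm_mul, norm_pow, RCLike.norm_conj, Circle.norm_coe, mul_one]
    gcongr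
    exact half_le_norm_circle_sub hz ξ
  linarith

lemma integrable_poissonKernel_smul {E : Type*} [NormedAddCommGroup E] [NormedSpace ℝ E]
    {z : ℂ} (hz : z ∈ Metric.ball (0 : ℂ) 1) {g : Circle → E} (hg : StronglyMeasurable g) {C : ℝ}
    (hC : ∀ ξ, ‖g ξ‖ ≤ C) :
    Integrable (fun ξ : Circle => poissonKernel 0 z ξ • g ξ) circleMeasure := by
  obtain ⟨K, hK⟩ := (isCompact_range (continuous_poissonKernel hz)).isBounded.exists_norm_le
  refine integrable_circle_of_bound
    ((continuous_poissonKernel hz).stronglyMeasurable.smul hg) (C := K * C) fun ξ => ?_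
  rw [norm_smul]
  have h1 := hK _ ⟨ξ, rfl⟩
  exact mul_le_mul h1 (hC ξ) (norm_nonneg _) ((norm_nonneg _).trans h1)

lemma MeasureTheory.MeasurePreserving.integral_comp_of_stronglyMeasurable {α β E : Type*}
    [MeasurableSpace α] [MeasurableSpace β] {μ : Measure α} {ν : Measure β}
    [NormedAddCommGroup E] [NormedSpace ℝ E] {T : α → β} (hT : MeasurePreserving T μ ν)
    {g : β → E} (hg : StronglyMeasurable g) : ∫ x, g (T x) ∂μ = ∫ y, g y ∂ν := by
  rw [← hT.map_eq, integral_map hT.measurable.aemeasurable hg.aestronglyMeasurable]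

/-- First order expansion at the origin of the Poisson integral. -/
lemma hasFDerivAt_integral_harm {φ : Circle → ℂ} (hφ : Measurable φ) {C : ℝ}
    (hC : ∀ ξ, ‖φ ξ‖ ≤ C) :
    HasFDerivAt (𝕜 := ℝ) (fun z => ∫ ξ, φ ξ ∂(harm z))
      (ContinuousLinearMap.mul ℝ ℂ (∫ ξ : Circle, (starRingEnd ℂ) ξ * φ ξ ∂circleMeasure) +
        (ContinuousLinearMap.mul ℝ ℂ (∫ ξ : Circle, ξ * φ ξ ∂circleMeasure)).comp
          (Complex.conjCLE : ℂ →L[ℝ] ℂ)) 0 := by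
  set D := (ContinuousLinearMap.mul ℝ ℂ (∫ ξ : Circle, (starRingEnd ℂ) ξ * φ ξ ∂circleMeasure) +
        (ContinuousLinearMap.mul ℝ ℂ (∫ ξ : Circle, ξ * φ ξ ∂circleMeasure)).comp
          (Complex.conjCLE : ℂ →L[ℝ] ℂ)) with hD
  have hφi : Integrable φ circleMeasure := integrable_circle_of_bound hφ.stronglyMeasurable hC
  have hm1 : Measurable fun ξ : Circle => (starRingEnd ℂ) (ξ : ℂ) :=
    Complex.continuous_conj.measurable.comp measurable_circle_coe
  have hi1 : Integrable (fun ξ : Circle => (starRingEnd ℂ) ξ * φ ξ) circleMeasure :=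
    integrable_circle_of_bound (hm1.mul hφ).stronglyMeasurable (C := C) fun ξ => by
      simpa [Circle.norm_coe] using hC ξ
  have hi2 : Integrable (fun ξ : Circle => ξ * φ ξ) circleMeasure :=
    integrable_circle_of_bound (measurable_circle_coe.mul hφ).stronglyMeasurable (C := C)
      fun ξ => by simpa [Circle.norm_coe] using hC ξ
  -- The kernel is `1 + z * conj ξ + conj z * ξ` with an error at most `4 * ‖z‖ ^ 2`, uniformly in
  -- `ξ`.
  have hO : (fun z => ∫ ξ, φ ξ ∂(harm z) - ∫ ξ, φ ξ ∂circleMeasure - D z) =O[𝓝 0]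
      fun z : ℂ => ‖z - 0‖ ^ 2 := by
    refine Asymptotics.IsBigO.of_bound (4 * C) ?_
    have : ∀ᶠ z : ℂ in 𝓝 0, ‖z‖ < 1 / 2 :=
      continuous_norm.continuousAt.eventually_lt_const (by simp)
    filter_upwards [this] with z hz
    have hb : z ∈ Metric.ball (0 : ℂ) 1 := by rw [mem_ball_zero_iff]; linarith
    have hi0 : Integrable (fun ξ : Circle => poissonKernel 0 z ξ • φ ξ) circleMeasure :=
      integrable_poissonKernel_smul hb hφ.stronglyMeasurable hC
    have hDz : D z = ∫ ξ : Circle, (z * ((starRingEnd ℂ) ξ * φ ξ) +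
        (starRingEnd ℂ) z * (ξ * φ ξ)) ∂circleMeasure := by
      rw [integral_add (hi1.const_mul _) (hi2.const_mul _), integral_const_mul, integral_const_mul]
      simp [hD, mul_comm]
    have hi3 : Integrable (fun ξ : Circle => poissonKernel 0 z ξ • φ ξ - φ ξ) circleMeasure :=
      hi0.sub hφi
    have hi4 : Integrable (fun ξ : Circle => z * ((starRingEnd ℂ) ξ * φ ξ) +
        (starRingEnd ℂ) z * (ξ * φ ξ)) circleMeasure := (hi1.const_mul _).add (hi2.const_mul _)
    rw [integral_harm hb, hDz, ← integral_sub hi0 hφi, ← integral_sub hi3 hi4]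
    refine (norm_integral_le_of_norm_le_const (C := 4 * ‖z‖ ^ 2 * C) (.of_forall fun ξ => ?_)).trans
      (le_of_eq ?_)
    · have h1 : poissonKernel 0 z ξ • φ ξ - φ ξ - (z * ((starRingEnd ℂ) ξ * φ ξ) +
          (starRingEnd ℂ) z * (ξ * φ ξ)) =
          ((poissonKernel 0 z ξ - 1 - 2 * (z * (starRingEnd ℂ) ξ).re : ℝ) : ℂ) * φ ξ := by
        have h2 := Complex.add_conj (z * (starRingEnd ℂ) ξ)
        rw [map_mul, Complex.conj_conj] at h2
        rw [Complex.real_smul]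
        push_cast at h2 ⊢
        rw [← h2]
        ring
      rw [h1, norm_mul, Complex.norm_real, Real.norm_eq_abs]
      exact mul_le_mul (abs_poissonKernel_sub_le hz.le ξ) (hC ξ) (norm_nonneg _) (by positivity)
    · simp
      ring
  have h0 := (hO.hasFDerivAt (𝕜 := ℝ) one_lt_two).add (D.hasFDerivAt (x := 0))
  have h1 := h0.add_const (∫ ξ, φ ξ ∂circleMeasure)
  rw [zero_add] at h1
  refine h1.congr_of_eventuallyEq (.of_forall fun z => ?_)
  simp

/-! ### Invariance of Lebesgue measure, and consequences of the Schwarz lemma. -/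

section Dynamics

variable {f : ℂ → ℂ} {T : Circle → Circle}

lemma IsBoundaryMap.measurePreserving (h : IsBoundaryMap f T) (hf0 : f 0 = 0) :
    MeasurePreserving T circleMeasure circleMeasure := by
  refine ⟨h.measurable, ?_⟩
  have := h.map_harm 0 (by simp)
  rwa [hf0, harm_zero] at this

/-- Both sides are coefficients of `conj z` in the derivative at `0` of `∫ φ ∘ T d(harm z) = ∫ φ
d(harm (f z))`, the right one found by the chain rule. This computes the conditional expectation of
the coordinate given `T`. -/
lemma IsBoundaryMap.integral_mul_comp (h : IsBoundaryMap f T) (hd : DifferentiableAt ℂ f 0)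
    (hf0 : f 0 = 0) {φ : Circle → ℂ} (hφ : Measurable φ) {C : ℝ} (hC : ∀ ξ, ‖φ ξ‖ ≤ C) :
    ∫ ξ : Circle, ξ * φ (T ξ) ∂circleMeasure =
      (starRingEnd ℂ) (deriv f 0) * ∫ ξ : Circle, ξ * φ ξ ∂circleMeasure := by
  have h1 := hasFDerivAt_integral_harm (hφ.comp h.measurable) (fun ξ => hC (T ξ))
  have h2 := hasFDerivAt_integral_harm hφ hC
  rw [← hf0] at h2
  have h3 := h2.comp 0 (hd.hasDerivAt.hasFDerivAt.restrictScalars ℝ)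
  have heq : (fun z => ∫ ξ, (φ ∘ T) ξ ∂(harm z)) =ᶠ[𝓝 0] (fun z => ∫ ξ, φ ξ ∂(harm z)) ∘ f := by
    filter_upwards [Metric.ball_mem_nhds (0 : ℂ) one_pos] with z hz
    exact h.integral_comp hφ.stronglyMeasurable hz
  have h4 := h1.unique (h3.congr_of_eventuallyEq heq)
  -- For `L z = A * z + B * conj z`, the combination `(L 1 + I * L I) / 2` isolates `B`.
  have e1 := congrArg (fun L : ℂ →L[ℝ] ℂ => L 1) h4
  have e2 := congrArg (fun L : ℂ →L[ℝ] ℂ => L Complex.I) h4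
  simp only [Function.comp_apply, add_apply, ContinuousLinearMap.coe_comp,
    ContinuousLinearMap.mul_apply', ContinuousLinearEquiv.coe_coe, Complex.conjCLE_apply, map_one,
    mul_one, Complex.conj_I, mul_neg, ContinuousLinearMap.coe_restrictScalars',
    ContinuousLinearMap.toSpanSingleton_apply, smul_eq_mul, one_mul, map_mul, neg_mul] at e1 e2
  set A₁ := ∫ ξ : Circle, (starRingEnd ℂ) ξ * φ (T ξ) ∂circleMeasure
  set B₁ := ∫ ξ : Circle, (starRingEnd ℂ) ξ * φ ξ ∂circleMeasure
  set A₂ := ∫ ξ : Circle, ξ * φ (T ξ) ∂circleMeasure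
  set B₂ := ∫ ξ : Circle, ξ * φ ξ ∂circleMeasure
  linear_combination (1 / 2) * e1 + (Complex.I / 2) * e2 - ((A₁ - A₂ - B₁ * deriv f 0 +
    B₂ * (starRingEnd ℂ) (deriv f 0)) / 2) * Complex.I_sq

lemma norm_dslope_lt_one (hd : DifferentiableOn ℂ f (Metric.ball 0 1))
    (hm : Set.MapsTo f (Metric.ball 0 1) (Metric.ball 0 1)) (hf0 : f 0 = 0)
    (hrot : ¬ IsDiscRotation f) {z : ℂ} (hz : z ∈ Metric.ball (0 : ℂ) 1) :
    ‖dslope f 0 z‖ < 1 := by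
  have hm' : Set.MapsTo f (Metric.ball 0 1) (Metric.closedBall (f 0) 1) := by
    rw [hf0]
    exact hm.mono_right Metric.ball_subset_closedBall
  have hle := Complex.norm_dslope_le_div_of_mapsTo_ball hd hm' hz
  rw [div_one] at hle
  refine lt_of_le_of_ne hle fun heq => hrot ?_
  have haff := Complex.affine_of_mapsTo_ball_of_norm_dslope_eq_div hd hm' hz (by rw [heq, div_one])
  refine ⟨⟨dslope f 0 z, mem_sphere_zero_iff_norm.2 heq⟩, fun w hw => ?_⟩
  have := haff hw
  simp only [hf0, sub_zero, zero_add, smul_eq_mul] at this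
  rw [this, mul_comm]

lemma norm_deriv_zero_lt_one (hd : DifferentiableOn ℂ f (Metric.ball 0 1))
    (hm : Set.MapsTo f (Metric.ball 0 1) (Metric.ball 0 1)) (hf0 : f 0 = 0)
    (hrot : ¬ IsDiscRotation f) : ‖deriv f 0‖ < 1 := by
  rw [← dslope_same]
  exact norm_dslope_lt_one hd hm hf0 hrot (by simp)

/-- Take `q` to be the maximum of `‖f z / z‖` (continued to `0`) on the closed disc of radius `r`;
it is below `1` by the equality case of Schwarz, and `f` keeps the disc invariant. -/
lemma exists_norm_iterate_le (hd : DifferentiableOn ℂ f (Metric.ball 0 1))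
    (hm : Set.MapsTo f (Metric.ball 0 1) (Metric.ball 0 1)) (hf0 : f 0 = 0)
    (hrot : ¬ IsDiscRotation f) {r : ℝ} (hr0 : 0 ≤ r) (hr : r < 1) :
    ∃ q, 0 ≤ q ∧ q < 1 ∧ ∀ n : ℕ, ∀ z : ℂ, ‖z‖ ≤ r → ‖f^[n] z‖ ≤ q ^ n := by
  have hsub : Metric.closedBall (0 : ℂ) r ⊆ Metric.ball 0 1 := Metric.closedBall_subset_ball hr
  have hcont : ContinuousOn (fun z => ‖dslope f 0 z‖) (Metric.closedBall 0 r) :=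
    (((Complex.differentiableOn_dslope (Metric.ball_mem_nhds (0 : ℂ) one_pos)).2
      hd).continuousOn.mono hsub).norm
  obtain ⟨z₀, hz₀, hmax⟩ := (isCompact_closedBall (0 : ℂ) r).exists_isMaxOn
    ⟨0, Metric.mem_closedBall_self hr0⟩ hcont
  have hq := norm_dslope_lt_one hd hm hf0 hrot (hsub hz₀)
  refine ⟨_, norm_nonneg (dslope f 0 z₀), hq, ?_⟩
  have key : ∀ z : ℂ, ‖z‖ ≤ r → ‖f z‖ ≤ ‖dslope f 0 z₀‖ * ‖z‖ := by
    intro z hz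
    have h1 : f z = z * dslope f 0 z := by
      have := sub_smul_dslope f 0 z
      rw [sub_zero, hf0, sub_zero, smul_eq_mul] at this
      exact this.symm
    rw [h1, norm_mul, mul_comm]
    gcongr
    exact hmax (mem_closedBall_zero_iff.2 hz)
  have key2 : ∀ n : ℕ, ∀ z : ℂ, ‖z‖ ≤ r → ‖f^[n] z‖ ≤ ‖dslope f 0 z₀‖ ^ n * ‖z‖ := by
    intro n
    induction n with
    | zero => intro z _; simp
    | succ n ih =>
      intro z hz
      have h1 := key z hz
      have h2 : ‖f z‖ ≤ r := h1.trans ((mul_le_of_le_one_left (norm_nonneg _) hq.le).trans hz)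
      rw [Function.iterate_succ_apply, pow_succ, mul_assoc]
      exact (ih _ h2).trans (by gcongr)
  exact fun n z hz => (key2 n z hz).trans
    (mul_le_of_le_one_right (by positivity) (hz.trans hr.le))

end Dynamics

/-! ### Uniform mixing of the iterates. -/

lemma abs_integral_mul_le {u v : Circle → ℝ} (hu : Measurable u) (hv : Measurable v) {A B a b : ℝ}
    (hA : ∀ ξ, |u ξ| ≤ A) (hB : ∀ ξ, |v ξ| ≤ B) (ha : 0 < a) (hb : 0 < b)
    (h1 : ∫ ξ, u ξ ^ 2 ∂circleMeasure ≤ a ^ 2) (h2 : ∫ ξ, v ξ ^ 2 ∂circleMeasure ≤ b ^ 2) :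
    |∫ ξ, u ξ * v ξ ∂circleMeasure| ≤ a * b := by
  have hi1 : Integrable (fun ξ => u ξ ^ 2) circleMeasure :=
    integrable_circle_of_bound (hu.pow_const 2).stronglyMeasurable (C := A ^ 2) fun ξ => by
      rw [norm_pow, Real.norm_eq_abs]
      exact pow_le_pow_left₀ (abs_nonneg _) (hA ξ) 2
  have hi2 : Integrable (fun ξ => v ξ ^ 2) circleMeasure :=
    integrable_circle_of_bound (hv.pow_const 2).stronglyMeasurable (C := B ^ 2) fun ξ => by
      rw [norm_pow, Real.norm_eq_abs]
      exact pow_le_pow_left₀ (abs_nonneg _) (hB ξ) 2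
  have h3 : ‖∫ ξ, u ξ * v ξ ∂circleMeasure‖ ≤
      ∫ ξ, (b / (2 * a) * u ξ ^ 2 + a / (2 * b) * v ξ ^ 2) ∂circleMeasure := by
    refine norm_integral_le_of_norm_le ((hi1.const_mul _).add (hi2.const_mul _))
      (.of_forall fun ξ => ?_)
    rw [Real.norm_eq_abs, abs_mul, ← sq_abs (u ξ), ← sq_abs (v ξ)]
    have h4 := sq_nonneg (b * |u ξ| - a * |v ξ|)
    have h5 : b / (2 * a) * |u ξ| ^ 2 + a / (2 * b) * |v ξ| ^ 2 =
      ((b * |u ξ|) ^ 2 + (a * |v ξ|) ^ 2) / (2 * (a * b)) := by field_simp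
    rw [h5, le_div_iff₀ (by positivity)]
    linarith
  rw [integral_add (hi1.const_mul _) (hi2.const_mul _), integral_const_mul,
    integral_const_mul] at h3
  refine h3.trans ?_
  calc _ ≤ b / (2 * a) * a ^ 2 + a / (2 * b) * b ^ 2 := by gcongr
    _ = a * b := by field_simp; ring

lemma poissonKernel_comm {r : ℝ} (ξ η : Circle) :
    poissonKernel 0 ((r : ℂ) * ξ) η = poissonKernel 0 ((r : ℂ) * η) ξ := by
  obtain ⟨s, rfl⟩ := Circle.exp_surjective ξ
  obtain ⟨t, rfl⟩ := Circle.exp_surjective η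
  rw [poissonKernel_exp, poissonKernel_exp, angularPoisson, angularPoisson, ← Real.cos_neg (t - s),
    neg_sub]

lemma continuous_poissonKernel_prod {r : ℝ} (hr0 : 0 ≤ r) (hr : r < 1) :
    Continuous fun p : Circle × Circle => poissonKernel 0 ((r : ℂ) * p.1) p.2 := by
  simp only [poissonKernel_circle]
  refine Continuous.div (by fun_prop) (by fun_prop) fun p => ?_
  have := circle_sub_ne_zero (ball_of_lt hr0 hr p.1) p.2
  positivity

/-- Fubini's theorem for the Poisson integral on a circle of radius `r`. -/
lemma integral_integral_harm_mul {r : ℝ} (hr0 : 0 ≤ r) (hr : r < 1) {g ψ : Circle → ℝ}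
    (hg : Measurable g) (hψ : Measurable ψ) {A B : ℝ} (hA : ∀ ξ, |g ξ| ≤ A) (hB : ∀ ξ, |ψ ξ| ≤ B) :
    ∫ ξ : Circle, (∫ η, g η ∂(harm ((r : ℂ) * ξ))) * ψ ξ ∂circleMeasure =
      ∫ η : Circle, g η * (∫ ξ, ψ ξ ∂(harm ((r : ℂ) * η))) ∂circleMeasure := by
  have hc := continuous_poissonKernel_prod hr0 hr
  obtain ⟨C, hC⟩ := (isCompact_range hc).isBounded.exists_norm_le
  have hint : Integrable (Function.uncurry fun ξ η : Circle =>
      poissonKernel 0 ((r : ℂ) * ξ) η * g η * ψ ξ) (circleMeasure.prod circleMeasure) := by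
    refine Integrable.of_bound ?_ (C * A * B) (.of_forall fun p => ?_)
    · exact ((hc.measurable.mul (hg.comp measurable_snd)).mul
        (hψ.comp measurable_fst)).aestronglyMeasurable
    · have h1 := hC _ ⟨p, rfl⟩
      have h0 := (norm_nonneg _).trans h1
      rw [Function.uncurry, norm_mul, norm_mul]
      have h2 := hA p.2
      have h3 := hB p.1
      rw [← Real.norm_eq_abs] at h2 h3
      have h4 := (norm_nonneg _).trans h2
      gcongr
  have hl : ∀ ξ : Circle, (∫ η, g η ∂(harm ((r : ℂ) * ξ))) * ψ ξ =
      ∫ η : Circle, poissonKernel 0 ((r : ℂ) * ξ) η * g η * ψ ξ ∂circleMeasure := by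
    intro ξ
    rw [integral_mul_const, integral_harm (ball_of_lt hr0 hr ξ)]
    rfl
  have hr : ∀ η : Circle, g η * (∫ ξ, ψ ξ ∂(harm ((r : ℂ) * η))) =
      ∫ ξ : Circle, poissonKernel 0 ((r : ℂ) * ξ) η * g η * ψ ξ ∂circleMeasure := by
    intro η
    rw [integral_harm (ball_of_lt hr0 hr η), ← integral_const_mul]
    congr 1
    ext ξ
    rw [poissonKernel_comm η ξ, smul_eq_mul]
    ring
  simp only [hl, hr]
  exact integral_integral_swap hint

lemma measurable_integral_harm {r : ℝ} (hr0 : 0 ≤ r) (hr : r < 1) {g : Circle → ℝ}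
    (hg : Measurable g) : Measurable fun ξ : Circle => ∫ η, g η ∂(harm ((r : ℂ) * ξ)) := by
  have h1 : (fun ξ : Circle => ∫ η, g η ∂(harm ((r : ℂ) * ξ))) =
      fun ξ : Circle => ∫ η : Circle, poissonKernel 0 ((r : ℂ) * ξ) η * g η ∂circleMeasure := by
    ext ξ
    rw [integral_harm (ball_of_lt hr0 hr ξ)]
    rfl
  rw [h1]
  refine StronglyMeasurable.measurable ?_
  exact StronglyMeasurable.integral_prod_right
    (f := fun ξ η : Circle => poissonKernel 0 ((r : ℂ) * ξ) η * g η)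
    ((continuous_poissonKernel_prod hr0 hr).measurable.mul
      (hg.comp measurable_snd)).stronglyMeasurable

/-- Indicators of measurable sets are approximated in mean square by their Poisson integrals. -/
lemma exists_integral_sq_sub_integral_harm_le {E : Set Circle} (hE : MeasurableSet E) {ε : ℝ}
    (hε : 0 < ε) : ∃ r : ℝ, 0 < r ∧ r < 1 ∧
      (∀ ξ : Circle, |E.indicator 1 ξ - ∫ η, E.indicator (1 : Circle → ℝ) η ∂(harm ((r : ℂ) * ξ))|
        ≤ 1) ∧
      ∫ ξ : Circle, (E.indicator 1 ξ - ∫ η, E.indicator (1 : Circle → ℝ) η ∂(harm ((r : ℂ) * ξ))) ^ 2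
        ∂circleMeasure ≤ ε := by
  set g : Circle → ℝ := E.indicator 1 with hg
  have hgm : Measurable g := measurable_one.indicator hE
  have hg0 : ∀ ξ, 0 ≤ g ξ := fun ξ => Set.indicator_nonneg (fun _ _ => zero_le_one) ξ
  have hg1 : ∀ ξ, g ξ ≤ 1 := fun ξ => Set.indicator_le_self' (fun _ _ => zero_le_one) ξ
  have hgb : ∀ ξ, |g ξ| ≤ 1 := fun ξ => by rw [abs_of_nonneg (hg0 ξ)]; exact hg1 ξ
  have hbd : ∀ r : ℝ, 0 < r → r < 1 → ∀ ξ : Circle,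
      |g ξ - ∫ η, g η ∂(harm ((r : ℂ) * ξ))| ≤ 1 := by
    intro r hr0 hr1 ξ
    have := isProbabilityMeasure_harm (ball_of_lt hr0.le hr1 ξ)
    have h0 : 0 ≤ ∫ η, g η ∂(harm ((r : ℂ) * ξ)) := integral_nonneg hg0
    have h1 : ∫ η, g η ∂(harm ((r : ℂ) * ξ)) ≤ 1 := by
      have := integral_mono (integrable_circle_of_bound (μ := harm ((r : ℂ) * ξ))
        hgm.stronglyMeasurable hgb) (integrable_const 1) hg1
      simpa using this
    rw [abs_le]
    constructor <;> linarith [hg0 ξ, hg1 ξ]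
  have hr2 : ∀ᶠ r in 𝓝[<] (1 : ℝ), 0 < r :=
    eventually_nhdsWithin_of_eventually_nhds (eventually_gt_nhds (by norm_num))
  have hlim : Tendsto (fun r : ℝ => ∫ ξ : Circle, (g ξ - ∫ η, g η ∂(harm ((r : ℂ) * ξ))) ^ 2
      ∂circleMeasure) (𝓝[<] 1) (𝓝 (∫ _ : Circle, (0 : ℝ) ∂circleMeasure)) := by
    refine tendsto_integral_filter_of_dominated_convergence (fun _ => 1) ?_ ?_
      (integrable_const 1) ?_
    · filter_upwards [hr2, self_mem_nhdsWithin] with r hr0 hr1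
      exact ((hgm.sub (measurable_integral_harm hr0.le hr1 hgm)).pow_const 2).aestronglyMeasurable
    · filter_upwards [hr2, self_mem_nhdsWithin] with r hr0 hr1
      refine .of_forall fun ξ => ?_
      rw [norm_pow]
      exact pow_le_one₀ (norm_nonneg _) (hbd r hr0 hr1 ξ)
    · filter_upwards [ae_tendsto_integral_harm_real hgm hgb] with ξ hξ
      simpa using (hξ.const_sub (g ξ)).pow 2
  rw [integral_zero] at hlim
  have h3 := hlim.eventually_le_const hε
  obtain ⟨r, h1, h2, h3⟩ := (hr2.and (eventually_mem_nhdsWithin.and h3)).exists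
  exact ⟨r, h1, h2, hbd r h1 h2, h3⟩

/-- Quantitative mixing: composition with high iterates decorrelates functions bounded in mean
square from a fixed set, uniformly. -/
theorem IsBoundaryMap.eventually_mixing {f : ℂ → ℂ} {T : Circle → Circle} (h : IsBoundaryMap f T)
    (hd : DifferentiableOn ℂ f (Metric.ball 0 1)) (hf0 : f 0 = 0) (hrot : ¬ IsDiscRotation f)
    {E : Set Circle} (hE : MeasurableSet E) {ε : ℝ} (hε : 0 < ε) :
    ∀ᶠ N : ℕ in atTop, ∀ ψ : Circle → ℝ, Measurable ψ → (∃ B, ∀ ξ, |ψ ξ| ≤ B) → ∀ s : ℝ, 0 < s →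
      ∫ ξ, ψ ξ ^ 2 ∂circleMeasure ≤ s ^ 2 →
      |∫ ξ in E, ψ (T^[N] ξ) ∂circleMeasure -
        circleMeasure.real E * ∫ ξ, ψ ξ ∂circleMeasure| ≤ ε * s := by
  obtain ⟨r, hr0, hr1, hgb, hg2⟩ := exists_integral_sq_sub_integral_harm_le hE
    (show 0 < (ε / 2) ^ 2 by positivity)
  obtain ⟨q, hq0, hq1, hq⟩ := exists_norm_iterate_le hd h.mapsTo hf0 hrot hr0.le hr1
  have hqlim := tendsto_pow_atTop_nhds_zero_of_lt_one hq0 hq1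
  -- With `‖w‖ ≤ q ^ N ≤ ε / 8` the kernel bound `4 * ‖w‖` becomes `ε / 2`; that bound itself needs
  -- `‖w‖ ≤ 1 / 2`.
  filter_upwards [hqlim.eventually_le_const (show 0 < ε / 8 by positivity),
    hqlim.eventually_le_const (show (0 : ℝ) < 1 / 2 by norm_num)] with N hN1 hN2 ψ hψ ⟨B, hB⟩ s hs hψs
  set g : Circle → ℝ := E.indicator 1 with hg
  have hgm : Measurable g := measurable_one.indicator hE
  have hg0 : ∀ ξ, 0 ≤ g ξ := fun ξ => Set.indicator_nonneg (fun _ _ => zero_le_one) ξ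
  have hg1 : ∀ ξ, g ξ ≤ 1 := fun ξ => Set.indicator_le_self' (fun _ _ => zero_le_one) ξ
  have hgb1 : ∀ ξ, |g ξ| ≤ 1 := fun ξ => by rw [abs_of_nonneg (hg0 ξ)]; exact hg1 ξ
  have hI := h.iterate N
  have hmp := hI.measurePreserving (Function.iterate_fixed hf0 N)
  set G : Circle → ℝ := fun ξ => ∫ η, g η ∂(harm ((r : ℂ) * ξ)) with hG
  have hGm : Measurable G := measurable_integral_harm hr0.le hr1 hgm
  have hψT : Measurable fun ξ => ψ (T^[N] ξ) := hψ.comp hI.measurable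
  -- The indicator splits into its Poisson extension `G` at radius `r` and a remainder small in mean
  -- square. The remainder is handled by Cauchy–Schwarz and invariance of the measure.
  have h1 : ∫ ξ in E, ψ (T^[N] ξ) ∂circleMeasure =
      ∫ ξ, (g ξ - G ξ) * ψ (T^[N] ξ) ∂circleMeasure + ∫ ξ, G ξ * ψ (T^[N] ξ) ∂circleMeasure := by
    have hGb : ∀ ξ, |G ξ| ≤ 2 := by
      intro ξ
      have := hgb ξ
      rw [abs_le] at this ⊢
      constructor <;> linarith [hg0 ξ, hg1 ξ]
    rw [← integral_add, ← integral_indicator hE]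
    · congr 1
      ext ξ
      by_cases hξ : ξ ∈ E <;> simp [hg, hξ, ← add_mul]
    · refine integrable_circle_of_bound ((hgm.sub hGm).mul hψT).stronglyMeasurable (C := 1 * B)
        fun ξ => ?_
      rw [norm_mul]
      exact mul_le_mul (hgb ξ) (hB _) (norm_nonneg _) zero_le_one
    · refine integrable_circle_of_bound (hGm.mul hψT).stronglyMeasurable (C := 2 * B)
        fun ξ => ?_
      rw [norm_mul]
      exact mul_le_mul (hGb ξ) (hB _) (norm_nonneg _) zero_le_two
  have h2 : |∫ ξ, (g ξ - G ξ) * ψ (T^[N] ξ) ∂circleMeasure| ≤ ε / 2 * s := by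
    refine abs_integral_mul_le (hgm.sub hGm) hψT hgb (fun ξ => hB _) (by positivity) hs hg2 ?_
    rwa [hmp.integral_comp_of_stronglyMeasurable (g := fun ξ => ψ ξ ^ 2)
      (hψ.pow_const 2).stronglyMeasurable]
  have hψi : Integrable ψ circleMeasure := integrable_circle_of_bound hψ.stronglyMeasurable hB
  have habs : ∫ ξ, |ψ ξ| ∂circleMeasure ≤ s := by
    have := abs_integral_mul_le hψ.abs (measurable_const (a := (1 : ℝ))) (A := B) (B := 1)
      (fun ξ => by rw [abs_abs]; exact hB ξ) (by simp) hs one_pos (by simpa using hψs) (by simp)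
    simp only [mul_one] at this
    exact (le_abs_self _).trans this
  have h3 : ∀ η : Circle, |∫ ξ, ψ (T^[N] ξ) ∂(harm ((r : ℂ) * η)) - ∫ ξ, ψ ξ ∂circleMeasure| ≤
      ε / 2 * s := by
    intro η
    have hz := ball_of_lt hr0.le hr1 η
    have hw := hq N ((r : ℂ) * η) (by simp [abs_of_pos hr0, Circle.norm_coe])
    set w := f^[N] ((r : ℂ) * η)
    have hwb : w ∈ Metric.ball (0 : ℂ) 1 := hI.mapsTo hz
    rw [hI.integral_comp hψ.stronglyMeasurable hz, integral_harm hwb, ← integral_sub _ hψi]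
    · rw [← Real.norm_eq_abs]
      refine (norm_integral_le_of_norm_le (hψi.abs.const_mul (ε / 2))
        (.of_forall fun ξ => ?_)).trans ?_
      · rw [smul_eq_mul, ← sub_one_mul, norm_mul]
        have := abs_poissonKernel_sub_one_le (hw.trans hN2) ξ
        rw [Real.norm_eq_abs, Real.norm_eq_abs]
        gcongr
        linarith
      · rw [integral_const_mul]
        gcongr
    · exact integrable_poissonKernel_smul hwb hψ.stronglyMeasurable hB
  -- Fubini moves the Poisson kernel from `g` to `ψ ∘ T^[N]`, whose harmonic average is one of `ψ`
  -- seen from a point near `0`, hence close to the mean of `ψ`.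
  have h4 : ∫ ξ, G ξ * ψ (T^[N] ξ) ∂circleMeasure - circleMeasure.real E * ∫ ξ, ψ ξ ∂circleMeasure =
      ∫ η, g η * (∫ ξ, ψ (T^[N] ξ) ∂(harm ((r : ℂ) * η)) - ∫ ξ, ψ ξ ∂circleMeasure)
        ∂circleMeasure := by
    rw [hG, integral_integral_harm_mul hr0.le hr1 hgm hψT hgb1 (fun ξ => hB _)]
    simp only [mul_sub]
    rw [integral_sub, integral_mul_const, hg, integral_indicator_one hE]
    · refine integrable_circle_of_bound (hgm.mul
        (measurable_integral_harm hr0.le hr1 hψT)).stronglyMeasurable (C := 1 * B) fun η => ?_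
      have := isProbabilityMeasure_harm (ball_of_lt hr0.le hr1 η)
      rw [norm_mul]
      refine mul_le_mul (hgb1 η) ?_ (norm_nonneg _) zero_le_one
      refine (norm_integral_le_of_norm_le_const (C := B) (.of_forall fun ξ => hB _)).trans (by simp)
    · exact (integrable_circle_of_bound hgm.stronglyMeasurable hgb1).mul_const _
  have h5 : |∫ ξ, G ξ * ψ (T^[N] ξ) ∂circleMeasure -
      circleMeasure.real E * ∫ ξ, ψ ξ ∂circleMeasure| ≤ ε / 2 * s := by
    rw [h4, ← Real.norm_eq_abs]
    refine (norm_integral_le_of_norm_le_const (C := ε / 2 * s) (.of_forall fun η => ?_)).trans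
      (by simp)
    rw [norm_mul]
    exact (mul_le_of_le_one_left (norm_nonneg _) (hgb1 η)).trans (h3 η)
  rw [h1, add_sub_assoc]
  exact (abs_add_le _ _).trans (by linarith)

/-! ### Rewriting the series in innovations. -/

/-- A measure preserving map `T` of the circle for which the conditional expectation of the
coordinate given `T` is `c T`, with `‖c‖ < 1`. -/
structure IsCenteredShift (T : Circle → Circle) (c : ℂ) : Prop where
  measurePreserving : MeasurePreserving T circleMeasure circleMeasure
  integral_eq_zero : ∀ φ : Circle → ℂ, Measurable φ → (∃ C, ∀ ξ, ‖φ ξ‖ ≤ C) →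
    ∫ ξ : Circle, ((ξ : ℂ) - c * T ξ) * φ (T ξ) ∂circleMeasure = 0
  norm_lt_one : ‖c‖ < 1

lemma IsBoundaryMap.isCenteredShift {f : ℂ → ℂ} {T : Circle → Circle} (h : IsBoundaryMap f T)
    (hd : DifferentiableOn ℂ f (Metric.ball 0 1)) (hf0 : f 0 = 0) (hrot : ¬ IsDiscRotation f) :
    IsCenteredShift T ((starRingEnd ℂ) (deriv f 0)) where
  measurePreserving := h.measurePreserving hf0
  integral_eq_zero φ hφ := by
    rintro ⟨C, hC⟩
    have hm : Measurable fun ξ : Circle => (ξ : ℂ) * φ ξ := measurable_circle_coe.mul hφ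
    have hi1 : Integrable (fun ξ : Circle => (ξ : ℂ) * φ (T ξ)) circleMeasure :=
      integrable_circle_of_bound
        (measurable_circle_coe.mul (hφ.comp h.measurable)).stronglyMeasurable (C := C)
        fun ξ => by simpa [Circle.norm_coe] using hC (T ξ)
    have hi2 : Integrable (fun ξ : Circle => (T ξ : ℂ) * φ (T ξ)) circleMeasure :=
      integrable_circle_of_bound (hm.comp h.measurable).stronglyMeasurable (C := C)
        fun ξ => by simpa [Circle.norm_coe] using hC (T ξ)
    simp only [sub_mul, mul_assoc]
    rw [integral_sub hi1 (hi2.const_mul _), integral_const_mul,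
      h.integral_mul_comp (hd.differentiableAt (Metric.ball_mem_nhds _ one_pos)) hf0 hφ hC,
      (h.measurePreserving hf0).integral_comp_of_stronglyMeasurable
        (g := fun ξ : Circle => (ξ : ℂ) * φ ξ) hm.stronglyMeasurable, sub_self]
  norm_lt_one := by
    rw [RCLike.norm_conj]
    exact norm_deriv_zero_lt_one hd h.mapsTo hf0 hrot

/-- The part of the coordinate orthogonal to the functions of `T`. -/
noncomputable def innovation (T : Circle → Circle) (c : ℂ) (ξ : Circle) : ℂ := ξ - c * T ξ

/-- A sum of reversed martingale differences followed by a last term. -/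
noncomputable def innovationSum (T : Circle → Circle) (c γ : ℂ) (b : ℕ → ℂ) (m : ℕ)
    (ξ : Circle) : ℂ :=
  ∑ i ∈ Finset.range m, b i * innovation T c (T^[i] ξ) + γ * T^[m] ξ

/-- All later terms are functions of `T ξ`, to which the first innovation is orthogonal; the moment
estimates are inductions on this splitting. -/
lemma innovationSum_succ (T : Circle → Circle) (c γ : ℂ) (b : ℕ → ℂ) (m : ℕ) (ξ : Circle) :
    innovationSum T c γ b (m + 1) ξ =
      b 0 * innovation T c ξ + innovationSum T c γ (fun i => b (i + 1)) m (T ξ) := by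
  simp only [innovationSum, Finset.sum_range_succ', Function.iterate_succ_apply,
    Function.iterate_zero_apply]
  ring

/-- The solution of `b (n + 1) = c * b n + a n` with `b 0 = 0`. -/
noncomputable def shiftSolve (c : ℂ) (a : ℕ → ℂ) : ℕ → ℂ
  | 0 => 0
  | n + 1 => c * shiftSolve c a n + a n

lemma sum_mul_iterate_eq (T : Circle → Circle) (c : ℂ) (a : ℕ → ℂ) (m : ℕ) (ξ : Circle) :
    ∑ i ∈ Finset.range m, a i * (T^[i] ξ : ℂ) =
      innovationSum T c (c * shiftSolve c a m) (fun i => shiftSolve c a (i + 1)) m ξ := by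
  induction m with
  | zero => simp [innovationSum, shiftSolve]
  | succ m ih =>
    rw [Finset.sum_range_succ, ih]
    simp only [innovationSum, Finset.sum_range_succ, innovation, shiftSolve,
      Function.iterate_succ_apply']
    ring

/-- Convexity gives `(‖c‖ x + y) ^ 2 ≤ ‖c‖ x ^ 2 + y ^ 2 / (1 - ‖c‖)`. Summing, and using that the
solution starts at `0`, the first term is absorbed on the left. -/
lemma sum_sq_shiftSolve_le {c : ℂ} (hc : ‖c‖ < 1) (a : ℕ → ℂ) (m : ℕ) :
    ∑ i ∈ Finset.range m, ‖shiftSolve c a (i + 1)‖ ^ 2 ≤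
      (∑ i ∈ Finset.range m, ‖a i‖ ^ 2) / (1 - ‖c‖) ^ 2 := by
  have h1c : 0 < 1 - ‖c‖ := by linarith
  have hstep : ∀ n, ‖shiftSolve c a (n + 1)‖ ^ 2 ≤
      ‖c‖ * ‖shiftSolve c a n‖ ^ 2 + ‖a n‖ ^ 2 / (1 - ‖c‖) := by
    intro n
    have h1 : ‖shiftSolve c a (n + 1)‖ ≤ ‖c‖ * ‖shiftSolve c a n‖ + ‖a n‖ := by
      rw [shiftSolve]
      exact (norm_add_le _ _).trans (by rw [norm_mul])
    have h2 := pow_le_pow_left₀ (norm_nonneg _) h1 2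
    refine h2.trans ?_
    rw [← sub_nonneg]
    have : ‖c‖ * ‖shiftSolve c a n‖ ^ 2 + ‖a n‖ ^ 2 / (1 - ‖c‖) -
        (‖c‖ * ‖shiftSolve c a n‖ + ‖a n‖) ^ 2 =
        ‖c‖ * ((1 - ‖c‖) * ‖shiftSolve c a n‖ - ‖a n‖) ^ 2 / (1 - ‖c‖) := by
      field_simp
      ring
    rw [this]
    positivity
  have hshift : ∑ i ∈ Finset.range m, ‖shiftSolve c a i‖ ^ 2 ≤
      ∑ i ∈ Finset.range m, ‖shiftSolve c a (i + 1)‖ ^ 2 := by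
    have h1 := Finset.sum_range_succ' (fun i => ‖shiftSolve c a i‖ ^ 2) m
    rw [Finset.sum_range_succ] at h1
    have h2 : ‖shiftSolve c a 0‖ ^ 2 = 0 := by simp [shiftSolve]
    have := sq_nonneg ‖shiftSolve c a m‖
    linarith
  have hsum := Finset.sum_le_sum fun i (_ : i ∈ Finset.range m) => hstep i
  rw [Finset.sum_add_distrib, ← Finset.mul_sum, ← Finset.sum_div] at hsum
  rw [le_div_iff₀ (by positivity)]
  have h3 := mul_le_mul_of_nonneg_left hshift (norm_nonneg c)
  have h4 : (∑ i ∈ Finset.range m, ‖shiftSolve c a (i + 1)‖ ^ 2) * (1 - ‖c‖) ≤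
      (∑ i ∈ Finset.range m, ‖a i‖ ^ 2) / (1 - ‖c‖) := by linarith
  rw [le_div_iff₀ h1c] at h4
  linarith

lemma sum_sq_le_shiftSolve {c : ℂ} (hc : ‖c‖ < 1) (a : ℕ → ℂ) (m : ℕ) :
    ∑ i ∈ Finset.range m, ‖a i‖ ^ 2 ≤
      4 * ∑ i ∈ Finset.range m, ‖shiftSolve c a (i + 1)‖ ^ 2 := by
  have hstep : ∀ n, ‖a n‖ ^ 2 ≤
      2 * ‖shiftSolve c a (n + 1)‖ ^ 2 + 2 * ‖shiftSolve c a n‖ ^ 2 := by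
    intro n
    have h1 : a n = shiftSolve c a (n + 1) - c * shiftSolve c a n := by
      rw [shiftSolve]
      ring
    have h2 : ‖a n‖ ≤ ‖shiftSolve c a (n + 1)‖ + ‖shiftSolve c a n‖ := by
      rw [h1]
      refine (norm_sub_le _ _).trans ?_
      rw [norm_mul]
      gcongr
      exact mul_le_of_le_one_left (norm_nonneg _) hc.le
    have h3 := pow_le_pow_left₀ (norm_nonneg _) h2 2
    nlinarith [sq_nonneg (‖shiftSolve c a (n + 1)‖ - ‖shiftSolve c a n‖)]
  have hshift : ∑ i ∈ Finset.range m, ‖shiftSolve c a i‖ ^ 2 ≤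
      ∑ i ∈ Finset.range m, ‖shiftSolve c a (i + 1)‖ ^ 2 := by
    have h1 := Finset.sum_range_succ' (fun i => ‖shiftSolve c a i‖ ^ 2) m
    rw [Finset.sum_range_succ] at h1
    have h2 : ‖shiftSolve c a 0‖ ^ 2 = 0 := by simp [shiftSolve]
    have := sq_nonneg ‖shiftSolve c a m‖
    linarith
  have hsum := Finset.sum_le_sum fun i (_ : i ∈ Finset.range m) => hstep i
  rw [Finset.sum_add_distrib, ← Finset.mul_sum, ← Finset.mul_sum] at hsum
  linarith

/-! ### Second and fourth moments of sums of innovations. -/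

namespace IsCenteredShift

variable {T : Circle → Circle} {c : ℂ}

lemma measurable (h : IsCenteredShift T c) : Measurable T := h.measurePreserving.measurable

lemma measurable_innovation (h : IsCenteredShift T c) : Measurable (innovation T c) :=
  measurable_circle_coe.sub ((measurable_circle_coe.comp h.measurable).const_mul c)

lemma norm_innovation_le (h : IsCenteredShift T c) (ξ : Circle) : ‖innovation T c ξ‖ ≤ 2 := by
  refine (norm_sub_le _ _).trans ?_
  rw [norm_mul, Circle.norm_coe, Circle.norm_coe]
  linarith [h.norm_lt_one]

lemma measurable_innovationSum (h : IsCenteredShift T c) (γ : ℂ) (b : ℕ → ℂ) (m : ℕ) :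
    Measurable (innovationSum T c γ b m) :=
  (Finset.measurable_fun_sum _ fun i _ =>
    (h.measurable_innovation.comp (h.measurable.iterate i)).const_mul _).add
      ((measurable_circle_coe.comp (h.measurable.iterate m)).const_mul _)

lemma norm_innovationSum_le (h : IsCenteredShift T c) (γ : ℂ) (b : ℕ → ℂ) (m : ℕ) (ξ : Circle) :
    ‖innovationSum T c γ b m ξ‖ ≤ ∑ i ∈ Finset.range m, ‖b i‖ * 2 + ‖γ‖ := by
  refine (norm_add_le _ _).trans (add_le_add (norm_sum_le_of_le _ fun i _ => ?_) ?_)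
  · rw [norm_mul]
    gcongr
    exact h.norm_innovation_le _
  · rw [norm_mul, Circle.norm_coe, mul_one]

lemma integral_re_eq_zero (h : IsCenteredShift T c) {φ : Circle → ℂ} (hφ : Measurable φ) {C : ℝ}
    (hC : ∀ ξ, ‖φ ξ‖ ≤ C) :
    ∫ ξ : Circle, (innovation T c ξ * φ (T ξ)).re ∂circleMeasure = 0 := by
  have hi : Integrable (fun ξ => innovation T c ξ * φ (T ξ)) circleMeasure :=
    integrable_circle_of_bound
      (h.measurable_innovation.mul (hφ.comp h.measurable)).stronglyMeasurable (C := 2 * C)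
      fun ξ => by
        rw [norm_mul]
        exact mul_le_mul (h.norm_innovation_le ξ) (hC _) (norm_nonneg _) zero_le_two
  have h1 := integral_re hi
  rw [show ∫ ξ, innovation T c ξ * φ (T ξ) ∂circleMeasure = 0 from
    h.integral_eq_zero φ hφ ⟨C, hC⟩] at h1
  simpa using h1

lemma _root_.integrable_circle_norm_pow {φ : Circle → ℂ} (hφ : Measurable φ) {C : ℝ}
    (hC : ∀ ξ, ‖φ ξ‖ ≤ C) (k : ℕ) : Integrable (fun ξ => ‖φ ξ‖ ^ k) circleMeasure :=
  integrable_circle_of_bound (hφ.norm.pow_const k).stronglyMeasurable (C := C ^ k) fun ξ => by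
    rw [norm_pow, norm_norm]
    exact pow_le_pow_left₀ (norm_nonneg _) (hC ξ) k

lemma integrable_re (h : IsCenteredShift T c) {φ : Circle → ℂ} (hφ : Measurable φ) {C : ℝ}
    (hC : ∀ ξ, ‖φ ξ‖ ≤ C) :
    Integrable (fun ξ => (innovation T c ξ * φ (T ξ)).re) circleMeasure :=
  Integrable.re (integrable_circle_of_bound
      (h.measurable_innovation.mul (hφ.comp h.measurable)).stronglyMeasurable (C := 2 * C)
      fun ξ => by
        rw [Pi.mul_apply, norm_mul]
        exact mul_le_mul (h.norm_innovation_le ξ) (hC _) (norm_nonneg _) zero_le_two)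

lemma integral_norm_pow_comp (h : IsCenteredShift T c) {φ : Circle → ℂ} (hφ : Measurable φ)
    (k : ℕ) : ∫ ξ, ‖φ (T ξ)‖ ^ k ∂circleMeasure = ∫ ξ, ‖φ ξ‖ ^ k ∂circleMeasure :=
  h.measurePreserving.integral_comp_of_stronglyMeasurable (g := fun ξ => ‖φ ξ‖ ^ k)
    (hφ.norm.pow_const k).stronglyMeasurable

lemma _root_.Complex.norm_add_sq' (x y : ℂ) :
    ‖x + y‖ ^ 2 = ‖x‖ ^ 2 + ‖y‖ ^ 2 + 2 * (x * (starRingEnd ℂ) y).re := by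
  rw [← Complex.normSq_eq_norm_sq, ← Complex.normSq_eq_norm_sq, ← Complex.normSq_eq_norm_sq,
    Complex.normSq_add]

lemma measurable_conj_mul {φ : Circle → ℂ} (hφ : Measurable φ) (β : ℂ) :
    Measurable fun ξ => β * (starRingEnd ℂ) (φ ξ) :=
  (Complex.continuous_conj.measurable.comp hφ).const_mul β

lemma integral_norm_add_sq_aux (h : IsCenteredShift T c) {φ : Circle → ℂ} (hφ : Measurable φ)
    {C : ℝ} (hC : ∀ ξ, ‖φ ξ‖ ≤ C) (β : ℂ) :
    ∫ ξ, ‖β * innovation T c ξ + φ (T ξ)‖ ^ 2 ∂circleMeasure =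
      ‖β‖ ^ 2 * ∫ ξ, ‖innovation T c ξ‖ ^ 2 ∂circleMeasure + ∫ ξ, ‖φ ξ‖ ^ 2 ∂circleMeasure := by
  have hpt : ∀ ξ, ‖β * innovation T c ξ + φ (T ξ)‖ ^ 2 = ‖β‖ ^ 2 * ‖innovation T c ξ‖ ^ 2 +
      ‖φ (T ξ)‖ ^ 2 + 2 * (innovation T c ξ * (β * (starRingEnd ℂ) (φ (T ξ)))).re := by
    intro ξ
    rw [Complex.norm_add_sq', norm_mul, mul_pow, mul_comm β, mul_assoc]
  have hb : ∀ ξ, ‖β * (starRingEnd ℂ) (φ ξ)‖ ≤ ‖β‖ * C := fun ξ => by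
    rw [norm_mul, RCLike.norm_conj]
    gcongr
    exact hC ξ
  have hm := measurable_conj_mul hφ β
  have hi1 := (integrable_circle_norm_pow h.measurable_innovation h.norm_innovation_le 2).const_mul
    (‖β‖ ^ 2)
  have hi2 := integrable_circle_norm_pow (hφ.comp h.measurable) (fun ξ => hC (T ξ)) 2
  have hi3 := (h.integrable_re hm hb).const_mul 2
  simp only [Function.comp_apply] at hi2
  have hi12 : Integrable (fun ξ => ‖β‖ ^ 2 * ‖innovation T c ξ‖ ^ 2 + ‖φ (T ξ)‖ ^ 2)
      circleMeasure := hi1.add hi2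
  simp only [hpt]
  rw [integral_add hi12 hi3, integral_add hi1 hi2, integral_const_mul,
    integral_const_mul, h.integral_re_eq_zero hm hb, h.integral_norm_pow_comp hφ]
  ring

/-- Pythagoras for `ξ = innovation T c ξ + c * T ξ`, where `‖ξ‖ = 1`. -/
lemma integral_norm_innovation_sq (h : IsCenteredShift T c) :
    ∫ ξ, ‖innovation T c ξ‖ ^ 2 ∂circleMeasure = 1 - ‖c‖ ^ 2 := by
  have h1 := h.integral_norm_add_sq_aux (φ := fun ξ : Circle => c * (ξ : ℂ))
    (measurable_circle_coe.const_mul c) (C := ‖c‖)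
    (fun ξ => by rw [norm_mul, Circle.norm_coe, mul_one]) 1
  simp [innovation, Circle.norm_coe] at h1
  simp only [innovation]
  linarith

lemma integral_norm_add_sq (h : IsCenteredShift T c) {φ : Circle → ℂ} (hφ : Measurable φ)
    {C : ℝ} (hC : ∀ ξ, ‖φ ξ‖ ≤ C) (β : ℂ) :
    ∫ ξ, ‖β * innovation T c ξ + φ (T ξ)‖ ^ 2 ∂circleMeasure =
      ‖β‖ ^ 2 * (1 - ‖c‖ ^ 2) + ∫ ξ, ‖φ ξ‖ ^ 2 ∂circleMeasure := by
  rw [h.integral_norm_add_sq_aux hφ hC, h.integral_norm_innovation_sq]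

/-- With `x = β * innovation` and `S = φ ∘ T`, the term of `‖x + S‖ ^ 4` linear in `x` is the
innovation times a function of `T`, so it integrates to `0`. The rest is at most `‖S‖ ^ 4 + 8 * ‖x‖
^ 2 * ‖S‖ ^ 2 + 3 * ‖x‖ ^ 4`, and `‖x‖ ≤ 2 * ‖β‖` yields `32` and `48`. -/
lemma integral_norm_add_pow_four_le (h : IsCenteredShift T c) {φ : Circle → ℂ} (hφ : Measurable φ)
    {C : ℝ} (hC : ∀ ξ, ‖φ ξ‖ ≤ C) (β : ℂ) :
    ∫ ξ, ‖β * innovation T c ξ + φ (T ξ)‖ ^ 4 ∂circleMeasure ≤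
      ∫ ξ, ‖φ ξ‖ ^ 4 ∂circleMeasure + 32 * ‖β‖ ^ 2 * ∫ ξ, ‖φ ξ‖ ^ 2 ∂circleMeasure +
        48 * ‖β‖ ^ 4 := by
  set χ : Circle → ℂ := fun ξ => (β * ‖φ ξ‖ ^ 2) * (starRingEnd ℂ) (φ ξ) with hχ
  have hχm : Measurable χ :=
    ((Complex.measurable_ofReal.comp hφ.norm).pow_const 2 |>.const_mul β).mul
      (Complex.continuous_conj.measurable.comp hφ)
  have hχb : ∀ ξ, ‖χ ξ‖ ≤ ‖β‖ * C ^ 2 * C := by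
    intro ξ
    simp only [hχ, norm_mul, norm_pow, RCLike.norm_conj, Complex.norm_real, norm_norm]
    have := hC ξ
    have := (norm_nonneg _).trans this
    gcongr
  have hpt : ∀ ξ, ‖β * innovation T c ξ + φ (T ξ)‖ ^ 4 ≤ ‖φ (T ξ)‖ ^ 4 +
      32 * ‖β‖ ^ 2 * ‖φ (T ξ)‖ ^ 2 + 48 * ‖β‖ ^ 4 + 4 * (innovation T c ξ * χ (T ξ)).re := by
    intro ξ
    set x := β * innovation T c ξ with hx
    set S := φ (T ξ) with hS
    have e1 : (innovation T c ξ * χ (T ξ)).re = ‖S‖ ^ 2 * (x * (starRingEnd ℂ) S).re := by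
      rw [← Complex.re_ofReal_mul]
      congr 1
      simp only [hχ, hx, ← hS]
      push_cast
      ring
    have e2 : ‖x + S‖ ^ 4 = (‖x + S‖ ^ 2) ^ 2 := by ring
    rw [e1, e2, Complex.norm_add_sq']
    set t := (x * (starRingEnd ℂ) S).re
    have ht : |t| ≤ ‖x‖ * ‖S‖ := by
      refine (Complex.abs_re_le_norm _).trans ?_
      rw [norm_mul, RCLike.norm_conj]
    have hn : ‖x‖ ≤ 2 * ‖β‖ := by
      rw [hx, norm_mul, mul_comm]
      gcongr
      exact h.norm_innovation_le ξ
    have hn2 := pow_le_pow_left₀ (norm_nonneg _) hn 2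
    have hn4 := pow_le_pow_left₀ (norm_nonneg _) hn 4
    have ht2 : t ^ 2 ≤ ‖x‖ ^ 2 * ‖S‖ ^ 2 := by
      rw [← sq_abs, ← mul_pow]
      exact pow_le_pow_left₀ (abs_nonneg _) ht 2
    have ht3 : t * ‖x‖ ^ 2 ≤ ‖x‖ * ‖S‖ * ‖x‖ ^ 2 := by
      gcongr
      exact (le_abs_self _).trans ht
    have hS2 : ‖x‖ ^ 2 * ‖S‖ ^ 2 ≤ (2 * ‖β‖) ^ 2 * ‖S‖ ^ 2 := by gcongr
    nlinarith [sq_nonneg (‖S‖ * ‖x‖ - ‖x‖ ^ 2)]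
  have hi1 := integrable_circle_norm_pow (hφ.comp h.measurable) (fun ξ => hC (T ξ)) 4
  have hi2 := (integrable_circle_norm_pow (hφ.comp h.measurable)
    (fun ξ => hC (T ξ)) 2).const_mul (32 * ‖β‖ ^ 2)
  have hi3 := (h.integrable_re hχm hχb).const_mul 4
  simp only [Function.comp_apply] at hi1 hi2
  have hi4 : Integrable (fun _ : Circle => 48 * ‖β‖ ^ 4) circleMeasure := integrable_const _
  have hi12 : Integrable (fun ξ => ‖φ (T ξ)‖ ^ 4 + 32 * ‖β‖ ^ 2 * ‖φ (T ξ)‖ ^ 2)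
      circleMeasure := hi1.add hi2
  have hi124 : Integrable (fun ξ => ‖φ (T ξ)‖ ^ 4 + 32 * ‖β‖ ^ 2 * ‖φ (T ξ)‖ ^ 2 +
      48 * ‖β‖ ^ 4) circleMeasure := hi12.add hi4
  refine (integral_mono_of_nonneg (.of_forall fun ξ => by positivity)
    (hi124.add hi3) (.of_forall hpt)).trans (le_of_eq ?_)
  simp only [Pi.add_apply]
  rw [integral_add hi124 hi3, integral_add hi12 hi4,
    integral_add hi1 hi2, integral_const_mul, integral_const_mul (4 : ℝ),
    h.integral_re_eq_zero hχm hχb, h.integral_norm_pow_comp hφ, h.integral_norm_pow_comp hφ]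
  simp

lemma integral_norm_sq_innovationSum (h : IsCenteredShift T c) (γ : ℂ) (b : ℕ → ℂ) (m : ℕ) :
    ∫ ξ, ‖innovationSum T c γ b m ξ‖ ^ 2 ∂circleMeasure =
      ‖γ‖ ^ 2 + (1 - ‖c‖ ^ 2) * ∑ i ∈ Finset.range m, ‖b i‖ ^ 2 := by
  induction m generalizing b with
  | zero => simp [innovationSum, Circle.norm_coe]
  | succ m ih =>
    simp only [innovationSum_succ]
    rw [h.integral_norm_add_sq (h.measurable_innovationSum _ _ _) (h.norm_innovationSum_le _ _ _),
      ih, Finset.sum_range_succ']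
    ring

/-- The constants close the induction: raising the inner sum by `‖b 0‖ ^ 2` raises the bound by `32
* ‖b 0‖ ^ 2` times the old bracket plus `64 * ‖b 0‖ ^ 4`, which dominates the increment of the
fourth moment. -/
lemma integral_norm_pow_four_innovationSum_le (h : IsCenteredShift T c) (γ : ℂ) (b : ℕ → ℂ)
    (m : ℕ) : ∫ ξ, ‖innovationSum T c γ b m ξ‖ ^ 4 ∂circleMeasure ≤
      4 * (‖γ‖ ^ 2 + 4 * ∑ i ∈ Finset.range m, ‖b i‖ ^ 2) ^ 2 := by
  induction m generalizing b with
  | zero =>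
    simp only [innovationSum, Finset.range_zero, Finset.sum_empty, zero_add, norm_mul,
      Circle.norm_coe, mul_one, integral_const, probReal_univ, smul_eq_mul, mul_zero, add_zero,
      one_mul]
    nlinarith [sq_nonneg (‖γ‖ ^ 2)]
  | succ m ih =>
    simp only [innovationSum_succ]
    refine (h.integral_norm_add_pow_four_le (h.measurable_innovationSum _ _ _)
      (h.norm_innovationSum_le _ _ _) _).trans ?_
    rw [h.integral_norm_sq_innovationSum, Finset.sum_range_succ']
    have h1 := ih fun i => b (i + 1)
    have h2 : (0 : ℝ) ≤ ∑ i ∈ Finset.range m, ‖b (i + 1)‖ ^ 2 :=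
      Finset.sum_nonneg fun i _ => by positivity
    set A := ∑ i ∈ Finset.range m, ‖b (i + 1)‖ ^ 2
    have h3 : (1 - ‖c‖ ^ 2) * A ≤ 4 * A := by nlinarith [sq_nonneg ‖c‖]
    have h4 : ‖b 0‖ ^ 2 * ((1 - ‖c‖ ^ 2) * A) ≤ ‖b 0‖ ^ 2 * (4 * A) := by gcongr
    nlinarith [sq_nonneg (‖b 0‖ ^ 2)]

/-- Expanding the square on `T ⁻¹' A`, the cross term vanishes since the indicator of `T ⁻¹' A` is a
function of `T`. This is the submartingale inequality for one step. -/
lemma setIntegral_norm_sq_le (h : IsCenteredShift T c) {φ : Circle → ℂ} (hφ : Measurable φ)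
    {C : ℝ} (hC : ∀ ξ, ‖φ ξ‖ ≤ C) (β : ℂ) {A : Set Circle} (hA : MeasurableSet A) :
    ∫ ξ in A, ‖φ ξ‖ ^ 2 ∂circleMeasure ≤
      ∫ ξ in T ⁻¹' A, ‖β * innovation T c ξ + φ (T ξ)‖ ^ 2 ∂circleMeasure := by
  set χ : Circle → ℂ := A.indicator fun ξ => β * (starRingEnd ℂ) (φ ξ) with hχ
  have hχm : Measurable χ := (measurable_conj_mul hφ β).indicator hA
  have hχb : ∀ ξ, ‖χ ξ‖ ≤ ‖β‖ * C := fun ξ => by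
    refine (norm_indicator_le_norm_self _ ξ).trans ?_
    rw [norm_mul, RCLike.norm_conj]
    gcongr
    exact hC ξ
  have hTA := h.measurable hA
  have hi1 : Integrable (fun ξ => ‖φ (T ξ)‖ ^ 2) circleMeasure :=
    integrable_circle_norm_pow (hφ.comp h.measurable) (fun ξ => hC (T ξ)) 2
  have hi2 : Integrable (fun ξ => ‖β * innovation T c ξ + φ (T ξ)‖ ^ 2) circleMeasure :=
    integrable_circle_norm_pow ((h.measurable_innovation.const_mul β).add (hφ.comp h.measurable))
      (C := ‖β‖ * 2 + C) (fun ξ => (norm_add_le _ _).trans (add_le_add (by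
        rw [norm_mul]
        gcongr
        exact h.norm_innovation_le ξ) (hC _))) 2
  have hi3 := (h.integrable_re hχm hχb).const_mul 2
  have h1 : ∫ ξ in A, ‖φ ξ‖ ^ 2 ∂circleMeasure = ∫ ξ in T ⁻¹' A, ‖φ (T ξ)‖ ^ 2 ∂circleMeasure :=
    ((h.measurePreserving.restrict_preimage hA).integral_comp_of_stronglyMeasurable
      (g := fun ξ => ‖φ ξ‖ ^ 2) (hφ.norm.pow_const 2).stronglyMeasurable).symm
  rw [h1, ← integral_indicator hTA, ← integral_indicator hTA]
  have h2 : ∫ ξ, ((T ⁻¹' A).indicator (fun ξ => ‖φ (T ξ)‖ ^ 2) ξ +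
      2 * (innovation T c ξ * χ (T ξ)).re) ∂circleMeasure =
      ∫ ξ, (T ⁻¹' A).indicator (fun ξ => ‖φ (T ξ)‖ ^ 2) ξ ∂circleMeasure := by
    rw [integral_add (hi1.indicator hTA) hi3, integral_const_mul, h.integral_re_eq_zero hχm hχb,
      mul_zero, add_zero]
  rw [← h2]
  refine integral_mono ((hi1.indicator hTA).add hi3) (hi2.indicator hTA) fun ξ => ?_
  by_cases hξ : T ξ ∈ A
  · rw [Set.indicator_of_mem (show ξ ∈ T ⁻¹' A from hξ), Set.indicator_of_mem
      (show ξ ∈ T ⁻¹' A from hξ), hχ, Set.indicator_of_mem hξ, Complex.norm_add_sq',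
      show β * innovation T c ξ * (starRingEnd ℂ) (φ (T ξ)) =
        innovation T c ξ * (β * (starRingEnd ℂ) (φ (T ξ))) by ring]
    have := sq_nonneg ‖β * innovation T c ξ‖
    linarith
  · rw [Set.indicator_of_notMem (show ξ ∉ T ⁻¹' A from hξ), Set.indicator_of_notMem
      (show ξ ∉ T ⁻¹' A from hξ), hχ, Set.indicator_of_notMem hξ]
    simp

/-! ### Reversed martingales, maximal inequality and convergence. -/

/-- The decreasing sequence of σ-algebras generated by the iterates of `T` up to the time `M`,
in reversed order. -/
noncomputable def reverseFiltration (h : IsCenteredShift T c) (M : ℕ) :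
    Filtration ℕ circleMeasurableSpace where
  seq i := MeasurableSpace.comap T^[M - i] circleMeasurableSpace
  mono' i j hij := by
    have hk : M - i = (M - i - (M - j)) + (M - j) := by omega
    change MeasurableSpace.comap T^[M - i] _ ≤ MeasurableSpace.comap T^[M - j] _
    rw [hk, Function.iterate_add, ← MeasurableSpace.comap_comp]
    exact MeasurableSpace.comap_mono ((h.measurable.iterate _).comap_le)
  le' i := (h.measurable.iterate _).comap_le

/-- The sum of the innovations from time `k` up to time `M`. -/
noncomputable def _root_.tailInnovationSum (T : Circle → Circle) (c : ℂ) (b : ℕ → ℂ) (M k : ℕ)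
    (ξ : Circle) : ℂ :=
  innovationSum T c 0 (fun i => b (k + i)) (M - k) (T^[k] ξ)

lemma submartingale_norm_sq (h : IsCenteredShift T c) (b : ℕ → ℂ) (M : ℕ) :
    Submartingale (fun i ξ => ‖tailInnovationSum T c b M (M - i) ξ‖ ^ 2) (h.reverseFiltration M)
      circleMeasure := by
  have hm : ∀ k, Measurable (innovationSum T c 0 (fun i => b (k + i)) (M - k)) :=
    fun k => h.measurable_innovationSum _ _ _
  refine submartingale_of_setIntegral_le_succ ?_ ?_ ?_
  · intro i
    refine Measurable.stronglyMeasurable ?_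
    exact ((hm (M - i)).norm.pow_const 2).comp (comap_measurable T^[M - i])
  · intro i
    exact integrable_circle_norm_pow ((hm _).comp (h.measurable.iterate _))
      (fun ξ => h.norm_innovationSum_le _ _ _ _) 2
  · rintro i s ⟨A, hA, rfl⟩
    rcases lt_or_ge i M with hi | hi
    · obtain ⟨k, hk1, hk2⟩ : ∃ k, M - i = k + 1 ∧ M - (i + 1) = k := ⟨M - (i + 1), by omega, rfl⟩
      rw [hk1, hk2]
      have hl := ((h.measurePreserving.iterate (k + 1)).restrict_preimage
        hA).integral_comp_of_stronglyMeasurable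
        (g := fun ξ => ‖innovationSum T c 0 (fun i => b (k + 1 + i)) (M - (k + 1)) ξ‖ ^ 2)
        ((hm (k + 1)).norm.pow_const 2).stronglyMeasurable
      have hr := ((h.measurePreserving.iterate k).restrict_preimage
        (h.measurable hA)).integral_comp_of_stronglyMeasurable
        (g := fun ξ => ‖innovationSum T c 0 (fun i => b (k + i)) (M - k) ξ‖ ^ 2)
        ((hm k).norm.pow_const 2).stronglyMeasurable
      rw [← Set.preimage_comp, ← Function.iterate_succ'] at hr
      simp only [tailInnovationSum]
      rw [hl, hr]
      have hMk : M - k = (M - (k + 1)) + 1 := by omega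
      rw [hMk]
      simp only [innovationSum_succ]
      convert h.setIntegral_norm_sq_le (hm (k + 1)) (fun ξ => h.norm_innovationSum_le _ _ _ ξ)
        (b (k + 0)) hA using 6
      congr 1
      ext i
      rw [add_assoc, add_comm 1]
    -- From index `M` on, truncated subtraction makes the process constant.
    · rw [show M - i = 0 by omega, show M - (i + 1) = 0 by omega]

/-- Doob's inequality for the squared tails; the terminal variable of the reversed process is the
full sum, whose second moment is known. -/
lemma measure_tail_le (h : IsCenteredShift T c) (b : ℕ → ℂ) (M : ℕ) {δ : ℝ} (hδ : 0 < δ) :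
    circleMeasure {ξ | ∃ k ≤ M, δ ≤ ‖tailInnovationSum T c b M k ξ‖} ≤
      ENNReal.ofReal ((∑ i ∈ Finset.range M, ‖b i‖ ^ 2) / δ ^ 2) := by
  have hdoob := maximal_ineq (h.submartingale_norm_sq b M) (fun i ξ => by positivity)
    (ε := (δ ^ 2).toNNReal) M
  have hδ2 : ((δ ^ 2).toNNReal : ℝ) = δ ^ 2 := Real.coe_toNNReal _ (by positivity)
  rw [hδ2] at hdoob
  set S := {ξ : Circle | δ ^ 2 ≤
    (Finset.range (M + 1)).sup' Finset.nonempty_range_add_one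
      fun k => ‖tailInnovationSum T c b M (M - k) ξ‖ ^ 2} with hS
  have hsub : {ξ | ∃ k ≤ M, δ ≤ ‖tailInnovationSum T c b M k ξ‖} ⊆ S := by
    rintro ξ ⟨k, hk, hkξ⟩
    rw [hS, Set.mem_ofPred_eq, Finset.le_sup'_iff]
    refine ⟨M - k, by simp, ?_⟩
    rw [show M - (M - k) = k by omega]
    exact pow_le_pow_left₀ hδ.le hkξ 2
  have hint : ∫ ξ in S, ‖tailInnovationSum T c b M (M - M) ξ‖ ^ 2 ∂circleMeasure ≤
      ∑ i ∈ Finset.range M, ‖b i‖ ^ 2 := by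
    rw [Nat.sub_self]
    have e1 : ∀ ξ, tailInnovationSum T c b M 0 ξ = innovationSum T c 0 b M ξ := fun ξ => by
      simp [tailInnovationSum]
    simp only [e1]
    refine (setIntegral_le_integral (integrable_circle_norm_pow (h.measurable_innovationSum 0 b M)
      (h.norm_innovationSum_le 0 b M) 2) (.of_forall fun ξ => by positivity)).trans ?_
    rw [h.integral_norm_sq_innovationSum]
    have : (0 : ℝ) ≤ ∑ i ∈ Finset.range M, ‖b i‖ ^ 2 := Finset.sum_nonneg fun i _ => by positivity
    simp only [norm_zero, ne_eq, OfNat.ofNat_ne_zero, not_false_eq_true, zero_pow, zero_add]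
    nlinarith [sq_nonneg ‖c‖]
  refine (measure_mono hsub).trans ?_
  rw [ENNReal.ofReal_div_of_pos (by positivity), ENNReal.le_div_iff_mul_le
    (.inl (by simpa using hδ.ne')) (.inl ENNReal.ofReal_ne_top), mul_comm]
  exact hdoob.trans (ENNReal.ofReal_le_ofReal hint)

/-- Maximal inequality for the partial sums of reversed martingale differences. -/
lemma measure_partial_le (h : IsCenteredShift T c) (b : ℕ → ℂ) (M : ℕ) {δ : ℝ} (hδ : 0 < δ) :
    circleMeasure {ξ | ∃ k ≤ M, 2 * δ ≤ ‖innovationSum T c 0 b k ξ‖} ≤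
      ENNReal.ofReal ((∑ i ∈ Finset.range M, ‖b i‖ ^ 2) / δ ^ 2) := by
  refine le_trans (measure_mono ?_) (h.measure_tail_le b M hδ)
  rintro ξ ⟨k, hk, hkξ⟩
  by_contra hcon
  simp only [Set.mem_ofPred_eq, not_exists, not_and, not_le] at hcon
  have h0 := hcon 0 (Nat.zero_le _)
  have h1 := hcon k hk
  -- A partial sum is a difference of two tails, whence the factor `2` in front of `δ`.
  have e : innovationSum T c 0 b k ξ =
      tailInnovationSum T c b M 0 ξ - tailInnovationSum T c b M k ξ := by
    obtain ⟨j, rfl⟩ := Nat.exists_eq_add_of_le hk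
    simp only [tailInnovationSum, innovationSum, Nat.sub_zero, zero_add, zero_mul, add_zero,
      Nat.add_sub_cancel_left, Function.iterate_zero_apply, Finset.sum_range_add,
      ← Function.iterate_add_apply]
    simp [add_comm]
  have := norm_sub_le (tailInnovationSum T c b M 0 ξ) (tailInnovationSum T c b M k ξ)
  rw [← e] at this
  linarith

lemma innovationSum_add_sub (T : Circle → Circle) (c : ℂ) (b : ℕ → ℂ) (N k : ℕ) (ξ : Circle) :
    innovationSum T c 0 b (N + k) ξ - innovationSum T c 0 b N ξ =
      innovationSum T c 0 (fun i => b (N + i)) k (T^[N] ξ) := by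
  simp only [innovationSum, zero_mul, add_zero, Finset.sum_range_add, ← Function.iterate_add_apply]
  simp [add_comm]

/-- The increments after `N` are partial sums of shifted coefficients evaluated at `T^[N] ξ`, so
invariance of the measure reduces this to the maximal inequality, uniformly in its length. -/
lemma measure_oscillation_le (h : IsCenteredShift T c) {b : ℕ → ℂ}
    (hb : Summable fun i => ‖b i‖ ^ 2) (N : ℕ) {δ : ℝ} (hδ : 0 < δ) :
    circleMeasure {ξ | ∃ k, 2 * δ ≤
      ‖innovationSum T c 0 b (N + k) ξ - innovationSum T c 0 b N ξ‖} ≤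
      ENNReal.ofReal ((∑' i, ‖b (i + N)‖ ^ 2) / δ ^ 2) := by
  have hb' : Summable fun i => ‖b (i + N)‖ ^ 2 := (summable_nat_add_iff N).2 hb
  set S : ℕ → Set Circle := fun M =>
    {ξ | ∃ k ≤ M, 2 * δ ≤ ‖innovationSum T c 0 (fun i => b (N + i)) k ξ‖} with hS
  have hSm : ∀ M, MeasurableSet (S M) := by
    intro M
    have : S M = ⋃ k ∈ Finset.range (M + 1),
        {ξ | 2 * δ ≤ ‖innovationSum T c 0 (fun i => b (N + i)) k ξ‖} := by
      ext ξ
      simp [hS]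
    rw [this]
    exact Finset.measurableSet_biUnion _ fun k _ =>
      measurableSet_le measurable_const (h.measurable_innovationSum _ _ _).norm
  have hmono : Monotone S := fun M M' hMM ξ ⟨k, hk, hξ⟩ => ⟨k, hk.trans hMM, hξ⟩
  have heq : {ξ | ∃ k, 2 * δ ≤
      ‖innovationSum T c 0 b (N + k) ξ - innovationSum T c 0 b N ξ‖} =
      T^[N] ⁻¹' ⋃ M, S M := by
    ext ξ
    simp only [innovationSum_add_sub, hS, Set.mem_ofPred_eq, Set.mem_preimage, Set.mem_iUnion]
    exact ⟨fun ⟨k, hk⟩ => ⟨k, k, le_rfl, hk⟩, fun ⟨_, k, _, hk⟩ => ⟨k, hk⟩⟩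
  rw [heq, (h.measurePreserving.iterate N).measure_preimage
    (MeasurableSet.iUnion hSm).nullMeasurableSet, hmono.measure_iUnion]
  refine iSup_le fun M => (h.measure_partial_le _ M hδ).trans (ENNReal.ofReal_le_ofReal ?_)
  gcongr
  simp only [add_comm N]
  exact hb'.sum_le_tsum _ fun i _ => by positivity

/-- Almost everywhere convergence of square summable series of reversed martingale differences. -/
theorem ae_tendsto_innovationSum (h : IsCenteredShift T c) {b : ℕ → ℂ}
    (hb : Summable fun i => ‖b i‖ ^ 2) :
    ∀ᵐ ξ : Circle ∂circleMeasure,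
      ∃ s, Tendsto (fun m => innovationSum T c 0 b m ξ) atTop (𝓝 s) := by
  have key : ∀ j : ℕ, ∀ᵐ ξ : Circle ∂circleMeasure, ∃ N, ∀ k,
      ‖innovationSum T c 0 b (N + k) ξ - innovationSum T c 0 b N ξ‖ < 2 * (1 / ((j : ℝ) + 1)) := by
    intro j
    have hδ : 0 < 1 / ((j : ℝ) + 1) := by positivity
    rw [ae_iff]
    refine le_antisymm ?_ zero_le
    have hlim : Tendsto (fun N => ENNReal.ofReal ((∑' i, ‖b (i + N)‖ ^ 2) /
        (1 / ((j : ℝ) + 1)) ^ 2)) atTop (𝓝 0) := by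
      have h1 := (tendsto_sum_nat_add fun i => ‖b i‖ ^ 2).div_const ((1 / ((j : ℝ) + 1)) ^ 2)
      rw [zero_div] at h1
      simpa using ENNReal.tendsto_ofReal h1
    refine ge_of_tendsto' hlim fun N => ?_
    refine le_trans (measure_mono ?_) (h.measure_oscillation_le hb N hδ)
    intro ξ hξ
    simp only [Set.mem_ofPred_eq, not_exists, not_forall, not_lt] at hξ ⊢
    exact hξ N
  filter_upwards [ae_all_iff.2 key] with ξ hξ
  refine cauchySeq_tendsto_of_complete (Metric.cauchySeq_iff'.2 fun ε hε => ?_)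
  obtain ⟨j, hj⟩ := exists_nat_one_div_lt (show 0 < ε / 2 by positivity)
  obtain ⟨N, hN⟩ := hξ j
  refine ⟨N, fun n hn => ?_⟩
  obtain ⟨k, rfl⟩ := Nat.exists_eq_add_of_le hn
  rw [dist_eq_norm]
  linarith [hN k]

end IsCenteredShift

/-! ### Convergence of the series, and square summability from boundedness. -/

lemma sum_Icc_one_eq_sum_range (u : ℕ → ℂ) (N : ℕ) :
    ∑ n ∈ Finset.Icc 1 N, u n = ∑ i ∈ Finset.range N, u (i + 1) := by
  induction N with
  | zero => simp
  | succ N ih => rw [Finset.sum_Icc_succ_top (by omega), ih, Finset.sum_range_succ]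

namespace IsCenteredShift

variable {T : Circle → Circle} {c : ℂ}

theorem ae_tendsto_sum_iterate (h : IsCenteredShift T c) {a : ℕ → ℂ}
    (ha : Summable fun n => ‖a (n + 1)‖ ^ 2) :
    ∀ᵐ ξ : Circle ∂circleMeasure, ∃ s,
      Tendsto (fun N => ∑ n ∈ Finset.Icc 1 N, a n * (T^[n] ξ : ℂ)) atTop (𝓝 s) := by
  set B := shiftSolve c fun n => a (n + 1) with hB
  have hBs : Summable fun i => ‖B (i + 1)‖ ^ 2 := by
    refine summable_of_sum_range_le (c := (∑' n, ‖a (n + 1)‖ ^ 2) / (1 - ‖c‖) ^ 2)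
      (fun i => by positivity) fun m => ?_
    refine (sum_sq_shiftSolve_le h.norm_lt_one _ m).trans ?_
    gcongr
    exact ha.sum_le_tsum _ fun i _ => by positivity
  have hB0 : Tendsto (fun m => ‖B m‖) atTop (𝓝 0) := by
    rw [← tendsto_add_atTop_iff_nat 1]
    have h1 := (Real.continuous_sqrt.tendsto _).comp hBs.tendsto_atTop_zero
    rw [Real.sqrt_zero] at h1
    refine h1.congr fun m => ?_
    rw [Function.comp_apply, Real.sqrt_sq (norm_nonneg _)]
  -- The series starts at `n = 1`, so the innovation sums are evaluated at `T ξ`.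
  have hconv := h.measurePreserving.quasiMeasurePreserving.ae (h.ae_tendsto_innovationSum hBs)
  filter_upwards [hconv] with ξ ⟨s, hs⟩
  refine ⟨s, ?_⟩
  have hrem : Tendsto (fun m => c * B m * (T^[m] (T ξ) : ℂ)) atTop (𝓝 0) := by
    rw [tendsto_zero_iff_norm_tendsto_zero]
    have h1 := hB0.const_mul ‖c‖
    rw [mul_zero] at h1
    refine h1.congr fun m => ?_
    rw [norm_mul, norm_mul, Circle.norm_coe, mul_one]
  have hsum := hs.add hrem
  rw [add_zero] at hsum
  refine hsum.congr fun m => ?_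
  rw [sum_Icc_one_eq_sum_range]
  simp only [Function.iterate_succ_apply]
  rw [sum_mul_iterate_eq T c (fun n => a (n + 1))]
  simp [innovationSum, hB]

/-- If the partial sums are bounded on a set of positive measure on which high iterates of `T` are
uniformly mixing, then the coefficients are square summable. -/
theorem summable_of_bounded (h : IsCenteredShift T c) {a : ℕ → ℂ} {E : Set Circle}
    (hE0 : 0 < circleMeasure E)
    (hmix : ∀ ε : ℝ, 0 < ε → ∀ᶠ N : ℕ in atTop, ∀ ψ : Circle → ℝ, Measurable ψ →
      (∃ B, ∀ ξ, |ψ ξ| ≤ B) → ∀ s : ℝ, 0 < s → ∫ ξ, ψ ξ ^ 2 ∂circleMeasure ≤ s ^ 2 →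
      |∫ ξ in E, ψ (T^[N] ξ) ∂circleMeasure -
        circleMeasure.real E * ∫ ξ, ψ ξ ∂circleMeasure| ≤ ε * s)
    {K : ℝ} (hK : ∀ ξ ∈ E, ∀ N, ‖∑ n ∈ Finset.Icc 1 N, a n * (T^[n] ξ : ℂ)‖ ≤ K) :
    Summable fun n => ‖a (n + 1)‖ ^ 2 := by
  have hc := h.norm_lt_one
  have hEr : 0 < circleMeasure.real E :=
    ENNReal.toReal_pos hE0.ne' (measure_ne_top _ _)
  have hc2 : 0 < 1 - ‖c‖ ^ 2 := by nlinarith [norm_nonneg c]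
  set κ := circleMeasure.real E * (1 - ‖c‖ ^ 2) with hκ
  have hκ0 : 0 < κ := by positivity
  -- Mixing is requested at time `N + 1`, the first exponent in the block after the `N`-th partial
  -- sum.
  obtain ⟨N, hN⟩ := ((tendsto_add_atTop_nat 1).eventually
    (hmix (κ / 20) (by positivity))).exists
  rw [← summable_nat_add_iff N]
  refine summable_of_sum_range_le (c := 4 * ((4 * K ^ 2 + κ / 20) / (κ / 2)))
    (fun i => by positivity) fun m => ?_
  set B := shiftSolve c fun i => a (i + N + 1) with hB
  refine (sum_sq_le_shiftSolve hc (fun i => a (i + N + 1)) m).trans ?_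
  set β := ∑ i ∈ Finset.range m, ‖B (i + 1)‖ ^ 2 with hβ
  have hβ0 : 0 ≤ β := Finset.sum_nonneg fun i _ => by positivity
  gcongr
  rw [le_div_iff₀ (by positivity)]
  set Ψ := innovationSum T c (c * B m) (fun i => B (i + 1)) m with hΨ
  have hΨm : Measurable Ψ := h.measurable_innovationSum _ _ _
  have hBm : ‖c * B m‖ ^ 2 ≤ β := by
    rw [norm_mul, mul_pow]
    refine (mul_le_of_le_one_left (by positivity) (pow_le_one₀ (norm_nonneg _) hc.le)).trans ?_
    rcases m with _ | m
    · simpa [hB, shiftSolve] using hβ0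
    · exact Finset.single_le_sum (f := fun i => ‖B (i + 1)‖ ^ 2) (fun i _ => by positivity)
        (Finset.self_mem_range_succ m)
  have hL2 := h.integral_norm_sq_innovationSum (c * B m) (fun i => B (i + 1)) m
  have hL4 := h.integral_norm_pow_four_innovationSum_le (c * B m) (fun i => B (i + 1)) m
  have hΨb := h.norm_innovationSum_le (c * B m) (fun i => B (i + 1)) m
  rw [← hΨ, ← hβ] at hL2 hL4
  rw [← hΨ] at hΨb
  -- The fourth moment is at most `4 * (5 * β) ^ 2 = (10 * β) ^ 2`; the added `1` keeps the mixing
  -- scale positive when `β = 0`.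
  have hsq : ∫ ξ, (‖Ψ ξ‖ ^ 2) ^ 2 ∂circleMeasure ≤ (10 * β + 1) ^ 2 := by
    simp only [← pow_mul]
    refine hL4.trans ?_
    have h1 : ‖c * B m‖ ^ 2 + 4 * β ≤ 5 * β := by linarith
    have h2 := pow_le_pow_left₀ (by positivity) h1 2
    nlinarith
  have hmixΨ := hN (fun ξ => ‖Ψ ξ‖ ^ 2) (hΨm.norm.pow_const 2)
    ⟨_, fun ξ => by
      rw [abs_of_nonneg (by positivity)]
      exact pow_le_pow_left₀ (norm_nonneg _) (hΨb ξ) 2⟩ (10 * β + 1) (by positivity) hsq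
  have hpt : ∀ ξ ∈ E, ‖Ψ (T^[N + 1] ξ)‖ ≤ 2 * K := by
    intro ξ hξ
    have h1 : Ψ (T^[N + 1] ξ) = ∑ n ∈ Finset.Icc 1 (N + m), a n * (T^[n] ξ : ℂ) -
        ∑ n ∈ Finset.Icc 1 N, a n * (T^[n] ξ : ℂ) := by
      rw [hΨ, ← sum_mul_iterate_eq, sum_Icc_one_eq_sum_range, sum_Icc_one_eq_sum_range,
        Finset.sum_range_add, add_sub_cancel_left]
      refine Finset.sum_congr rfl fun i _ => ?_
      rw [← Function.iterate_add_apply, ← add_assoc, add_comm i N]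
    rw [h1]
    refine (norm_sub_le _ _).trans ?_
    linarith [hK ξ hξ (N + m), hK ξ hξ N]
  have hup : ∫ ξ in E, ‖Ψ (T^[N + 1] ξ)‖ ^ 2 ∂circleMeasure ≤ 4 * K ^ 2 := by
    have h1 := norm_setIntegral_le_of_norm_le_const (μ := circleMeasure) (s := E)
      (f := fun ξ => ‖Ψ (T^[N + 1] ξ)‖ ^ 2) (C := 4 * K ^ 2) (measure_lt_top _ _) fun ξ hξ => by
        rw [norm_pow, norm_norm]
        refine (pow_le_pow_left₀ (norm_nonneg _) (hpt ξ hξ) 2).trans (le_of_eq (by ring))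
    refine (le_abs_self _).trans (h1.trans ?_)
    exact mul_le_of_le_one_right (by positivity) measureReal_le_one
  have hlow : κ * β ≤ circleMeasure.real E * ∫ ξ, ‖Ψ ξ‖ ^ 2 ∂circleMeasure := by
    rw [hL2, hκ, mul_assoc]
    gcongr
    exact le_add_of_nonneg_left (by positivity)
  -- The mixing error is `κ / 20 * (10 * β + 1) = κ * β / 2 + κ / 20`, so half of the lower bound `κ
  -- * β` survives against `4 * K ^ 2`.
  have := (abs_le.1 hmixΨ).1
  linarith

end IsCenteredShift

/-! ### The equivalence. -/

theorem theorem1p1 (f : ℂ → ℂ) (hf : IsInnerFunction f) (hf0 : f 0 = 0)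
    (hrot : ¬ IsDiscRotation f) (a : ℕ → ℂ) :
    List.TFAE [
      ∀ᵐ ξ ∂circleMeasure, IteratesDefinedAt f ξ ∧
        ∃ s : ℂ, Tendsto (fun N : ℕ => iteratePartialSum f a ξ N) atTop (𝓝 s),
      0 < circleMeasure {ξ : Circle | IteratesDefinedAt f ξ ∧
        BddAbove (Set.range fun N : ℕ => ‖iteratePartialSum f a ξ N‖)},
      Summable (fun n : ℕ => ‖a (n + 1)‖ ^ 2)] := by
  obtain ⟨T, hT⟩ := hf.exists_isBoundaryMap
  have hd := hf.differentiableOn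
  have hs := hT.isCenteredShift hd hf0 hrot
  have hlim : ∀ᵐ ξ : Circle ∂circleMeasure, ∀ n, HasRadialLimit f^[n] ξ (T^[n] ξ) :=
    ae_all_iff.2 fun n => (hT.iterate n).hasRadialLimit
  have hdef : ∀ ξ : Circle, (∀ n, HasRadialLimit f^[n] ξ (T^[n] ξ)) → IteratesDefinedAt f ξ :=
    fun ξ hξ n _ => ⟨_, hξ n⟩
  have hsum : ∀ ξ : Circle, (∀ n, HasRadialLimit f^[n] ξ (T^[n] ξ)) → ∀ N,
      iteratePartialSum f a ξ N = ∑ n ∈ Finset.Icc 1 N, a n * (T^[n] ξ : ℂ) := by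
    intro ξ hξ N
    refine Finset.sum_congr rfl fun n _ => ?_
    rw [boundaryValue, (hξ n).limUnder_eq]
  tfae_have 3 → 1 := by
    intro ha
    filter_upwards [hlim, hs.ae_tendsto_sum_iterate ha] with ξ hξ ⟨s, h⟩
    exact ⟨hdef ξ hξ, s, h.congr fun N => (hsum ξ hξ N).symm⟩
  tfae_have 1 → 2 := by
    intro h
    have : ∀ᵐ ξ : Circle ∂circleMeasure, IteratesDefinedAt f ξ ∧
        BddAbove (Set.range fun N : ℕ => ‖iteratePartialSum f a ξ N‖) := by
      filter_upwards [h] with ξ ⟨h1, s, h2⟩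
      exact ⟨h1, h2.norm.bddAbove_range⟩
    rw [measure_eq_measure_of_null_sdiff (t := Set.univ) (Set.subset_univ _)
      (by rwa [← Set.compl_eq_univ_sdiff]), measure_univ]
    exact one_pos
  tfae_have 2 → 3 := by
    intro h
    -- Written with `T`, these level sets are measurable; up to a null set they cover the set of
    -- bounded partial sums, so one of them has positive measure.
    set S : ℕ → Set Circle := fun K =>
      ⋂ N, {ξ | ‖∑ n ∈ Finset.Icc 1 N, a n * (T^[n] ξ : ℂ)‖ ≤ K} with hS
    have hSm : ∀ K, MeasurableSet (S K) := fun K => MeasurableSet.iInter fun N =>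
      measurableSet_le (Finset.measurable_fun_sum _ fun n _ =>
        ((measurable_circle_coe.comp (hT.measurable.iterate n)).const_mul _)).norm
        measurable_const
    obtain ⟨K, hK⟩ : ∃ K, 0 < circleMeasure (S K) := by
      by_contra hcon
      simp only [not_exists, not_lt, nonpos_iff_eq_zero] at hcon
      refine h.ne' (le_antisymm ?_ zero_le)
      rw [← measure_union_null (measure_iUnion_null hcon) (ae_iff.1 hlim)]
      refine measure_mono fun ξ hξ => ?_
      obtain ⟨_, M, hM⟩ := hξ
      by_cases hξ' : ∀ n, HasRadialLimit f^[n] ξ (T^[n] ξ)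
      · left
        obtain ⟨K, hMK⟩ := exists_nat_ge M
        refine Set.mem_iUnion.2 ⟨K, Set.mem_iInter.2 fun N => ?_⟩
        rw [Set.mem_ofPred_eq, ← hsum ξ hξ' N]
        exact (hM ⟨N, rfl⟩).trans hMK
      · right
        exact hξ'
    exact hs.summable_of_bounded hK
      (fun ε hε => hT.eventually_mixing hd hf0 hrot (hSm K) hε)
      fun ξ hξ N => Set.mem_iInter.1 hξ N
  tfae_finish
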